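/- **Setting.** Let $n\ge 2$, let $G=(V,E)$ be a connected undirected graph on $V=\{1,\dots,n\}$ with signed incidence matrix $A\in\{0,1,-1\}^{E\times n}$ (any orientation), let $\tilde A=A\otimes I_d$, $M=\|A^\top A\|_2$, $K=I_n-\mathbf 1\mathbf 1^\top/n$, $\tilde K=K\otimes I_d$, and let $\tilde Q=(\tilde A^\top\tilde A)^\dagger$ be the Moore–Penrose inverse. For a symmetric matrix $W$ write $\langle x\mid y\rangle_W=x^\top Wy$ and $\|x\|_W^2=x^\top Wx$. Let $f_i:\mathbb R^d\to\mathbb R$ ($i\in V$), $f=\frac1n\sum_i f_i$ with $f^\star=\inf f>-\infty$, and $\nabla\mathbf f(\mathbf X)=(\nabla f_1(\mathbf X_1),\dots,\nabla f_n(\mathbf X_n))$ for $\mathbf X=(\mathbf X_1,\dots,\mathbf X_n)\in\mathbb R^{nd}$; let $\bar{\mathbf X}=\frac1n\sum_i\mathbf X_i$. **Assumptions.** (1) Each $f_i$ is differentiable and $\|\nabla f_i(x)-\nabla f_i(y)\|\le L\|x-y\|$ for all $x,y$, where $L\ge0$. (2) $\tilde\rho_1\ge\tilde\rho_2>0$ and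 $\tilde\rho_2K\preceq A^\top A\preceq\tilde\rho_1K$. (3) $\delta\in(0,1]$, and the compressor $\hat Q$ with random seeds $\xi_i^t$ satisfies $\mathbb E\|\hat Q(x;\xi_i^t)-x\|^2\le(1-\delta)^2\|x\|^2$ for all $x\in\mathbb R^d$, $i\in V$ and $t$; the seed vectors $\xi^t=(\xi_1^t,\dots,\xi_n^t)$ are independent over $t$. **Algorithm (TiCoPD).** For $\theta,\eta,\tilde\alpha>0$ put $\alpha=\frac1{1/\tilde\alpha+\theta M}$ and $\beta=\alpha/\tilde\alpha$. From deterministic $\mathbf X^0,\hat{\mathbf X}^0\in\mathbb R^{nd}$ and $\tilde\lambda^0=\tilde A^\top\lambda^0$ with $\lambda^0\in\mathbb R^{|E|d}$, iterate for $t\ge0$ $$\mathbf X^{t+1}=\beta\mathbf X^t+(1-\beta)\hat{\mathbf X}^t-\alpha\big(\nabla\mathbf f(\mathbf X^t)+\tilde\lambda^t+\theta\tilde A^\top\tilde A\hat{\mathbf X}^t\big),\qquad \tilde\lambda^{t+1}=\tilde\lambda^t+\eta\tilde A^\top\tilde A\hat{\mathbf X}^t,$$ $$\hat{\mathbf X}^{t+1}_i=\hat{\mathbf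 X}^t_i+\hat Q(\mathbf X^{t+1}_i-\hat{\mathbf X}^t_i;\xi_i^{t+1})\quad(i\in V).$$ **Constants.** Let ${\tt a}>0$ be arbitrary, $\delta_2=\max\{16\eta/\delta,1\}$, $\tilde\delta=\max\Big\{\frac{(1-\delta)^2(1-\delta/2)^2}{(1-\delta/2)^2-(1-\delta)^2},1\Big\}$, $\delta_1=12\max\{2,2\tilde\rho_2^{-1}\eta^{-1},\delta_2\tilde\delta\}$, $$\theta_{lb}=\max\Big\{\tfrac{4L^2}{n\tilde\rho_2{\tt a}},\ \tfrac2{\tilde\rho_2}\Big(1+2L+8\eta\tilde\rho_1^2\tilde\rho_2^{-1}+\delta_1\big(\tfrac32+3L^2+\eta\tilde\rho_1+\tfrac{\tilde\rho_1^2}2\big)\Big)\Big\},$$ $$\alpha_{ub}=\frac{\max\{16\eta,\delta\}}{320\,\theta^2}\min\Big\{\frac1{M^2},\frac{n{\tt a}}{M^2},\frac1{\tilde\rho_1^2},\frac1{n{\tt a}}\Big\}.$$ With $\mathbf v^t=\alpha\big(\tilde\lambda^t+\nabla\mathbf f((\mathbf 1\otimes I_d)\bar{\mathbf X}^t)\big)$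 let $$F_t=f(\bar{\mathbf X}^t)-f^\star+\frac{{\tt a}}{\eta\alpha}\|\mathbf v^t\|^2_{\tilde Q+\alpha((\frac{\delta_1}2(\theta+\eta)-\theta)-\delta_2\theta)\tilde K}+{\tt a}\|\mathbf X^t\|^2_{\tilde K}+\delta_1{\tt a}\langle\mathbf X^t\mid\mathbf v^t\rangle_{\tilde K}+\delta_2{\tt a}\|\hat{\mathbf X}^t-\mathbf X^t\|^2 .$$ **Theorem.** If $\eta>0$, $\theta\ge\theta_{lb}$ and $\alpha\le\alpha_{ub}$, then $F_t\ge0$ for all $t$, all the expectations below are finite, and for every $T\ge1$ $$\frac1T\sum_{t=0}^{T-1}\mathbb E\|\nabla f(\bar{\mathbf X}^t)\|^2\le\frac{\mathbb E F_0-\mathbb E F_T}{\alpha T/16},\qquad \frac1T\sum_{t=0}^{T-1}\mathbb E\|\mathbf X^t\|_{\tilde K}^2\le\frac{\mathbb E F_0-\mathbb E F_T}{\alpha\theta\tilde\rho_2{\tt a}T/4}.$$ In particular there is a constant $C$, independent of $T$, such that both averages are at most $C/T$ for all $T\ge1$. -/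

import Mathlib

open MeasureTheory ProbabilityTheory

noncomputable section

/-- The decision space `ℝ^d` of one agent, with the Euclidean norm. -/
abbrev Vec (d : ℕ) : Type := EuclideanSpace ℝ (Fin d)

/-! ### Stacked vectors

A vector of `ℝ^{nd}` is a family of `n` blocks in `ℝ^d`, and `blockMul B` is the action of the
Kronecker product `B ⊗ I_d` on such families. -/

/-- `(B ⊗ I_d) X`, block by block. -/
def blockMul {ι κ : Type*} [Fintype κ] {d : ℕ} (B : Matrix ι κ ℝ) (X : κ → Vec d) :
    ι → Vec d :=
  fun i => ∑ j, B i j • X j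

/-- The weighted inner product `⟨X | Y⟩_W = Xᵀ (W ⊗ I_d) Y` of stacked vectors. -/
def wInner {n d : ℕ} (W : Matrix (Fin n) (Fin n) ℝ) (X Y : Fin n → Vec d) : ℝ :=
  ∑ i, inner ℝ (X i) (blockMul W Y i)

/-- The weighted squared norm `‖X‖_W² = Xᵀ (W ⊗ I_d) X` of a stacked vector. -/
def wNormSq {n d : ℕ} (W : Matrix (Fin n) (Fin n) ℝ) (X : Fin n → Vec d) : ℝ :=
  wInner W X X

/-- The squared Euclidean norm of a stacked vector of `ℝ^{nd}`. -/
def stackNormSq {n d : ℕ} (X : Fin n → Vec d) : ℝ := ∑ i, ‖X i‖ ^ 2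

/-- The network average `X̄ = (1/n) ∑ᵢ Xᵢ`. -/
def netAvg {n d : ℕ} (X : Fin n → Vec d) : Vec d := (n : ℝ)⁻¹ • ∑ i, X i

/-- The consensus error matrix `K = I - 11ᵀ/n`. -/
def consensusMatrix (n : ℕ) : Matrix (Fin n) (Fin n) ℝ :=
  1 - Matrix.of fun _ _ => (n : ℝ)⁻¹

/-! ### The incidence matrix and the graph Laplacian -/

/-- An (arbitrary) orientation of the edges of `G`. -/
structure EdgeOrientation {n : ℕ} (G : SimpleGraph (Fin n)) where
  /-- the endpoint that gets the sign `+1` -/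
  tail : G.edgeSet → Fin n
  /-- the endpoint that gets the sign `-1` -/
  head : G.edgeSet → Fin n
  edge_eq : ∀ e : G.edgeSet, s(tail e, head e) = (e : Sym2 (Fin n))

/-- The incidence matrix `A ∈ {0, 1, -1}^{E × n}` of the oriented graph. -/
def incidence {n : ℕ} {G : SimpleGraph (Fin n)} (o : EdgeOrientation G) :
    Matrix G.edgeSet (Fin n) ℝ :=
  fun e i => if i = o.tail e then 1 else if i = o.head e then -1 else 0

/-- The graph Laplacian `AᵀA`. -/
def laplacian {n : ℕ} {G : SimpleGraph (Fin n)} [Fintype G.edgeSet] (o : EdgeOrientation G) :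
    Matrix (Fin n) (Fin n) ℝ :=
  (incidence o).transpose * incidence o

/-- The spectral norm `‖AᵀA‖₂`. -/
def laplacianNorm {n : ℕ} {G : SimpleGraph (Fin n)} [Fintype G.edgeSet]
    (o : EdgeOrientation G) : ℝ :=
  ‖Matrix.toEuclideanCLM (𝕜 := ℝ) (laplacian o)‖

/-! ### The Moore-Penrose inverse -/

/-- The four Penrose equations: `Q` is the Moore-Penrose inverse of the real matrix `B`. -/
structure IsMoorePenrose {n : ℕ} (B Q : Matrix (Fin n) (Fin n) ℝ) : Prop where
  mul_mul_self : B * Q * B = B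
  self_mul_mul : Q * B * Q = Q
  symm_left : (B * Q).transpose = B * Q
  symm_right : (Q * B).transpose = Q * B

/-- The Penrose equations have at most one solution. -/
theorem IsMoorePenrose.unique {n : ℕ} {B Q R : Matrix (Fin n) (Fin n) ℝ}
    (hQ : IsMoorePenrose B Q) (hR : IsMoorePenrose B R) : Q = R := by
  have h1 : B * Q = B * R := by
    calc B * Q = (B * R * B) * Q := by rw [hR.mul_mul_self]
      _ = (B * R).transpose * (B * Q).transpose := by
          rw [hR.symm_left, hQ.symm_left, Matrix.mul_assoc (B * R)]
      _ = (B * Q * B * R).transpose := by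
          rw [← Matrix.transpose_mul, Matrix.mul_assoc (B * Q)]
      _ = B * R := by rw [hQ.mul_mul_self, hR.symm_left]
  have h2 : Q * B = R * B := by
    calc Q * B = Q * (B * R * B) := by rw [hR.mul_mul_self]
      _ = (Q * B).transpose * (R * B).transpose := by
          rw [hR.symm_right, hQ.symm_right]; simp only [Matrix.mul_assoc]
      _ = (R * (B * Q * B)).transpose := by
          rw [← Matrix.transpose_mul]; simp only [Matrix.mul_assoc]
      _ = R * B := by rw [hQ.mul_mul_self, hR.symm_right]
  calc Q = Q * B * Q := hQ.self_mul_mul.symm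
    _ = R * (B * Q) := by rw [h2, Matrix.mul_assoc]
    _ = R := by rw [h1, ← Matrix.mul_assoc, hR.self_mul_mul]

/-- A symmetric real matrix has a Moore-Penrose inverse. -/
theorem exists_isMoorePenrose {n : ℕ} {B : Matrix (Fin n) (Fin n) ℝ} (hB : B.IsHermitian) :
    ∃ Q, IsMoorePenrose B Q := by
  obtain ⟨U, D, hU, hBU⟩ : ∃ (U : Matrix (Fin n) (Fin n) ℝ) (D : Fin n → ℝ),
      U.transpose * U = 1 ∧ B = U * Matrix.diagonal D * U.transpose := by
    refine ⟨hB.eigenvectorUnitary, hB.eigenvalues, ?_, ?_⟩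
    · have h := Unitary.coe_star_mul_self hB.eigenvectorUnitary
      simpa [Matrix.star_eq_conjTranspose, Matrix.conjTranspose_eq_transpose_of_trivial] using h
    · have h := hB.spectral_theorem
      rw [Unitary.conjStarAlgAut_apply] at h
      simpa [Matrix.star_eq_conjTranspose, Matrix.conjTranspose_eq_transpose_of_trivial,
        Function.comp_def] using h
  have key : ∀ a b : Fin n → ℝ, (U * Matrix.diagonal a * U.transpose) *
      (U * Matrix.diagonal b * U.transpose) =
      U * Matrix.diagonal (fun i => a i * b i) * U.transpose := by
    intro a b
    calc _ = U * Matrix.diagonal a * (U.transpose * U) * Matrix.diagonal b * U.transpose := by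
          simp only [Matrix.mul_assoc]
      _ = _ := by rw [hU, Matrix.mul_one, Matrix.mul_assoc U, Matrix.diagonal_mul_diagonal]
  have symm : ∀ a : Fin n → ℝ, (U * Matrix.diagonal a * U.transpose).transpose =
      U * Matrix.diagonal a * U.transpose := by
    intro a
    rw [Matrix.transpose_mul, Matrix.transpose_mul, Matrix.transpose_transpose,
      Matrix.diagonal_transpose, Matrix.mul_assoc]
  refine ⟨U * Matrix.diagonal (fun i => (D i)⁻¹) * U.transpose, ?_, ?_, ?_, ?_⟩
  · rw [hBU, key, key]; congr 3; funext i; by_cases h : D i = 0 <;> simp [h]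
  · rw [hBU, key, key]; congr 3; funext i; by_cases h : D i = 0 <;> simp [h]
  · rw [hBU, key, symm]
  · rw [hBU, key, symm]

open Classical in
/-- The Moore-Penrose inverse of a real square matrix. -/
def pinv {n : ℕ} (B : Matrix (Fin n) (Fin n) ℝ) : Matrix (Fin n) (Fin n) ℝ :=
  if h : ∃ Q, IsMoorePenrose B Q then h.choose else 0

/-- `pinv (AᵀA)` is the Moore-Penrose inverse of the Laplacian. -/
theorem isMoorePenrose_pinv_laplacian {n : ℕ} {G : SimpleGraph (Fin n)} [Fintype G.edgeSet]
    (o : EdgeOrientation G) : IsMoorePenrose (laplacian o) (pinv (laplacian o)) := by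
  have hB : (laplacian o).IsHermitian := by
    simp [laplacian, Matrix.IsHermitian, Matrix.conjTranspose_eq_transpose_of_trivial,
      Matrix.transpose_mul]
  have h := exists_isMoorePenrose hB
  rw [pinv, dif_pos h]
  exact h.choose_spec

/-! ### The objective -/

/-- The global objective `f(x) = (1/n) ∑ᵢ fᵢ(x)`. -/
def avgObj {n d : ℕ} (f : Fin n → Vec d → ℝ) (x : Vec d) : ℝ := (n : ℝ)⁻¹ * ∑ i, f i x

/-- The global gradient `∇f(x) = (1/n) ∑ᵢ ∇fᵢ(x)`. -/
def avgGrad {n d : ℕ} (f : Fin n → Vec d → ℝ) (x : Vec d) : Vec d :=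
  (n : ℝ)⁻¹ • ∑ i, gradient (f i) x

/-! ### The TiCoPD algorithm -/

/-- The variables of TiCoPD: primal `X`, surrogate `X̂` and dual `λ̃ = Ãᵀλ`. -/
structure TiCoPDState (n d : ℕ) where
  /-- primal variable -/
  x : Fin n → Vec d
  /-- surrogate variable -/
  xhat : Fin n → Vec d
  /-- transformed dual variable -/
  lam : Fin n → Vec d

/-- One iteration of TiCoPD. Here `q` is the compression operator with the randomness of this
iteration already inserted, agent by agent. -/
def ticopdStep {n d : ℕ} {G : SimpleGraph (Fin n)} [Fintype G.edgeSet] (o : EdgeOrientation G)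
    (f : Fin n → Vec d → ℝ) (α β θ η : ℝ) (q : Fin n → Vec d → Vec d)
    (s : TiCoPDState n d) : TiCoPDState n d :=
  let xnew : Fin n → Vec d := fun i =>
    β • s.x i + (1 - β) • s.xhat i
      - α • (gradient (f i) (s.x i) + s.lam i + θ • blockMul (laplacian o) s.xhat i)
  { x := xnew
    xhat := fun i => s.xhat i + q i (xnew i - s.xhat i)
    lam := fun i => s.lam i + η • blockMul (laplacian o) s.xhat i }

/-- The TiCoPD iterates started at `X⁰`, `X̂⁰`, `λ̃⁰ = Ãᵀλ⁰`, driven by a realisation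
`z 1, z 2, …` of the random seeds of the compressors. -/
def ticopd {n d : ℕ} {G : SimpleGraph (Fin n)} [Fintype G.edgeSet] (o : EdgeOrientation G)
    (f : Fin n → Vec d → ℝ) (α β θ η : ℝ) {S : Fin n → Type*}
    (Q : (i : Fin n) → Vec d → S i → Vec d)
    (x₀ xhat₀ : Fin n → Vec d) (lam₀ : G.edgeSet → Vec d)
    (z : ℕ → (i : Fin n) → S i) : ℕ → TiCoPDState n d
  | 0 => { x := x₀, xhat := xhat₀, lam := blockMul (incidence o).transpose lam₀ }
  | t + 1 => ticopdStep o f α β θ η (fun i u => Q i u (z (t + 1) i))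
      (ticopd o f α β θ η Q x₀ xhat₀ lam₀ z t)

/-! ### Constants and the Lyapunov function -/

/-- `δ₂ = max {16η/δ, 1}`. -/
def delta2 (η δ : ℝ) : ℝ := max (16 * η / δ) 1

/-- `δ̃ = max {(1-δ)²(1-δ/2)² / ((1-δ/2)² - (1-δ)²), 1}`. -/
def deltaTilde (δ : ℝ) : ℝ :=
  max ((1 - δ) ^ 2 * (1 - δ / 2) ^ 2 / ((1 - δ / 2) ^ 2 - (1 - δ) ^ 2)) 1

/-- `δ₁ = 12 max {2, 2/(ρ₂η), δ₂δ̃}`. -/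
def delta1 (η δ ρ₂ : ℝ) : ℝ :=
  12 * max 2 (max (2 * ρ₂⁻¹ * η⁻¹) (delta2 η δ * deltaTilde δ))

/-- The lower bound on the penalty `θ`. -/
def thetaLB (n : ℕ) (L ρ₁ ρ₂ η δ a : ℝ) : ℝ :=
  max (4 * L ^ 2 / (n * ρ₂ * a))
    (2 / ρ₂ * (1 + 2 * L + 8 * η * ρ₁ ^ 2 * ρ₂⁻¹
      + delta1 η δ ρ₂ * (3 / 2 + 3 * L ^ 2 + η * ρ₁ + ρ₁ ^ 2 / 2)))

/-- The upper bound on the primal step size `α`. -/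
def alphaUB (n : ℕ) (M ρ₁ η δ θ a : ℝ) : ℝ :=
  max (16 * η) δ / (320 * θ ^ 2) *
    min (1 / M ^ 2) (min (n * a / M ^ 2) (min (1 / ρ₁ ^ 2) (1 / (n * a))))

/-- The blocks of `v = α (λ̃ + ∇𝐟((1 ⊗ I_d) X̄))`. -/
def dualError {n d : ℕ} (f : Fin n → Vec d → ℝ) (α : ℝ) (s : TiCoPDState n d) :
    Fin n → Vec d :=
  fun i => α • (s.lam i + gradient (f i) (netAvg s.x))

/-- The Lyapunov function `F` evaluated at the current variables of the algorithm. -/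
def lyapunov {n d : ℕ} {G : SimpleGraph (Fin n)} [Fintype G.edgeSet] (o : EdgeOrientation G)
    (f : Fin n → Vec d → ℝ) (fstar α θ η δ ρ₂ a : ℝ) (s : TiCoPDState n d) : ℝ :=
  let δ₁ := delta1 η δ ρ₂
  let δ₂ := delta2 η δ
  let K := consensusMatrix n
  let v := dualError f α s
  avgObj f (netAvg s.x) - fstar
    + a / (η * α) *
        wNormSq (pinv (laplacian o) + (α * ((δ₁ / 2 * (θ + η) - θ) - δ₂ * θ)) • K) v
    + a * wNormSq K s.x + δ₁ * a * wInner K s.x v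
    + δ₂ * a * stackNormSq (fun i => s.xhat i - s.x i)

end

/-! The theorem is the telescoped form of a one-step inequality: in expectation, `F` drops by at
least `α/16 ‖∇f(X̄)‖² + (αθρ₂a/4) ‖X‖²_K`. Summing over `t` and using `F ≥ 0` gives both rates.
Almost all of the argument is pathwise (`lyapunov_step_le`). Randomness enters only through the new
compression error, whose mean square is bounded because the fresh seed is independent of the vector
being compressed (`SquareIntegrableState.step`).

Put `e = X̂ - X`, `B = AᵀA` and `M = ‖B‖`. Since `1 - β = αθM`, the algorithm reads `X' = X + αθM e
- αu - V - αθ B(X+e)` and `V' = V + α(η B(X+e) + w)`. Here `V` is the dual error, `u` compares the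
gradients at `X` with those at the average, and `w` is the change of the gradients at the average.
Three mechanisms are then coupled.

Average: `λ̃` and `B(·)` have zero mean, so `X̄` makes a gradient step perturbed by `θM ē`. The
descent lemma yields `-α/4 ‖∇f‖² - α/2 ‖g‖²` plus errors, with `g` the mean local gradient. The
`‖g‖²` term pays for everything proportional to `‖X̄' - X̄‖²`, in particular `‖w‖²`
(`StepSizes.gradientWeight_le`).

Consensus: after projection by `K`, the cross term `δ₁⟨X, v⟩` produces `-δ₁‖v‖²`, while `‖X‖²_K`
produces `-2αθ⟨X, BX⟩`. The remaining terms are absorbed by Young's inequality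
(`consensus_identity`, `consensus_descent`).

Compression: `X' - X̂ = (X' - X) - e`, and Young's inequality with the weight `δ̃` leaves a gain of
`(3/4)δδ₂‖e‖²` and a multiple of `‖X' - X‖²`, which the size of `δ₁` covers (`compression_young`).
-/

noncomputable section

/-! ### Constants: step sizes and the compression factor. -/

/-- The relations between the constants of the algorithm that the descent argument uses, with
`D = δ δ₂`, `N = n a` and `M` the norm of the Laplacian. -/
structure StepSizes (L ρ₂ η θ α M N δ₁ δ₂ D : ℝ) : Prop where
  L_nonneg : 0 ≤ L
  ρ₂_pos : 0 < ρ₂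
  η_pos : 0 < η
  α_pos : 0 < α
  N_pos : 0 < N
  D_pos : 0 < D
  one_le_M : 1 ≤ M
  δ₁_ge : 24 ≤ δ₁
  δ₁_mul_ge : 24 ≤ δ₁ * (ρ₂ * η)
  δ₁_mul_D_ge : 18 / 5 ≤ δ₁ * D
  δ₂_ge : 1 ≤ δ₂
  δ₂_le : δ₂ ≤ δ₁ / 12
  L_le : 4 * L ≤ θ * ρ₂
  δ₁_le : 3 * δ₁ ≤ θ * ρ₂
  L_sq_le : 6 * (δ₁ * L ^ 2) ≤ θ * ρ₂
  δ₁_mul_η_le : 2 * (δ₁ * η) ≤ θ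
  θ_ge : 72 ≤ θ
  δ₁_le_θ : 3 * δ₁ ≤ θ
  D_le : D ≤ θ
  D_le_mul : D ≤ η * θ
  δ₁_mul_D_le : δ₁ * D ≤ 8 * (θ * ρ₂)
  α_mul_M : α * (θ * M) ^ 2 ≤ D / 320
  α_mul_M_N : α * (θ * M) ^ 2 ≤ N * D / 320
  α_mul_N : α * N * θ ^ 2 ≤ D / 320
  α_le : α * θ ^ 2 ≤ D / 320
  α_mul_δ₁ : α * δ₁ ≤ 1 / 2880
  α_mul_L_sq : α * (δ₁ * L ^ 2) ≤ 1 / 1920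
  α_mul_L : α * L ≤ 1 / 1280

theorem deltaTilde_ge_one (δ : ℝ) : 1 ≤ deltaTilde δ := le_max_right _ _

/-- For `δ ≤ 1/3` the quotient in `δ̃`, times `δ`, equals `(1-δ)²(1-δ/2)²/(1-3δ/4)`, at least
`(4/9)(25/36) > 3/10`; for larger `δ` the floor `1` in the maximum is enough. This bound pays for
the coupling `⟨v, e⟩` in `consensus_descent`. -/
theorem deltaTilde_lower {δ : ℝ} (hδ : 0 < δ) (hδ1 : δ ≤ 1) : 3 / 10 ≤ δ * deltaTilde δ := by
  by_cases h : δ ≤ 1 / 3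
  · have h1 : (1 - δ) ^ 2 * (1 - δ / 2) ^ 2 / ((1 - δ / 2) ^ 2 - (1 - δ) ^ 2) ≤ deltaTilde δ :=
      le_max_left _ _
    have h2 : (1 - δ / 2) ^ 2 - (1 - δ) ^ 2 = δ * (1 - 3 * δ / 4) := by ring
    have h3 : 0 < 1 - 3 * δ / 4 := by linarith
    rw [h2] at h1
    have h4 : 3 / 10 ≤ (1 - δ) ^ 2 * (1 - δ / 2) ^ 2 / (1 - 3 * δ / 4) := by
      rw [le_div_iff₀ h3]
      have e1 : 4 / 9 ≤ (1 - δ) ^ 2 := by nlinarith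
      have e2 : 25 / 36 ≤ (1 - δ / 2) ^ 2 := by nlinarith
      nlinarith
    calc (3 / 10 : ℝ) ≤ _ := h4
      _ = δ * ((1 - δ) ^ 2 * (1 - δ / 2) ^ 2 / (δ * (1 - 3 * δ / 4))) := by
        field_simp
      _ ≤ _ := mul_le_mul_of_nonneg_left h1 hδ.le
  · have := deltaTilde_ge_one δ
    nlinarith

/-- Young's inequality for the compression error, with the weights that define `δ̃`. -/
theorem compression_young {δ : ℝ} (hδ : 0 < δ) (hδ1 : δ ≤ 1) {p q r : ℝ}
    (hr : r ^ 2 ≤ (p + q) ^ 2) :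
    (1 - δ) ^ 2 * r ^ 2 ≤ (1 - 3 / 4 * δ) * p ^ 2 + deltaTilde δ * q ^ 2 := by
  have h1 : (1 - δ) ^ 2 * (1 - δ / 2) ^ 2 / ((1 - δ / 2) ^ 2 - (1 - δ) ^ 2) ≤ deltaTilde δ :=
    le_max_left _ _
  have h2 : 0 < (1 - δ / 2) ^ 2 - (1 - δ) ^ 2 := by nlinarith
  set A := (1 - δ) ^ 2 with hA
  set C := (1 - δ / 2) ^ 2 with hC
  have hA0 : 0 ≤ A := sq_nonneg _
  -- The Young parameter is chosen so that the gap between the two sides is a perfect square over `C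
  -- - A`.
  have h3 : A * (p + q) ^ 2 ≤ C * p ^ 2 + A * C / (C - A) * q ^ 2 := by
    have : C * p ^ 2 + A * C / (C - A) * q ^ 2 - A * (p + q) ^ 2
        = ((C - A) * p - A * q) ^ 2 / (C - A) := by
      field_simp
      ring
    have : 0 ≤ ((C - A) * p - A * q) ^ 2 / (C - A) := by positivity
    linarith
  have h4 : C ≤ 1 - 3 / 4 * δ := by rw [hC]; nlinarith
  calc A * r ^ 2 ≤ A * (p + q) ^ 2 := mul_le_mul_of_nonneg_left hr hA0
    _ ≤ _ := h3
    _ ≤ _ := add_le_add (mul_le_mul_of_nonneg_right h4 (sq_nonneg _))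
      (mul_le_mul_of_nonneg_right h1 (sq_nonneg _))

-- Clearing denominators in `thetaLB` and `alphaUB` leaves polynomial inequalities that later
-- arguments combine linearly. The numerator of `alphaUB` is exactly `D = δδ₂ = max {16η, δ}`, and
-- `ρ₁, M ≥ 1` make the various powers comparable.
set_option maxHeartbeats 1000000 in
theorem stepSizes_of_bounds {n : ℕ} (hn : 2 ≤ n) {L ρ₁ ρ₂ η δ a θ α M : ℝ} (hL : 0 ≤ L)
    (hρ₂ : 0 < ρ₂) (hρ : ρ₂ ≤ ρ₁) (hρ₁ : 1 ≤ ρ₁) (hM : 1 ≤ M) (hδ : 0 < δ) (hδ1 : δ ≤ 1)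
    (ha : 0 < a) (hη : 0 < η) (hα : 0 < α) (hθ : thetaLB n L ρ₁ ρ₂ η δ a ≤ θ)
    (hαub : α ≤ alphaUB n M ρ₁ η δ θ a) :
    StepSizes L ρ₂ η θ α M (n * a) (delta1 η δ ρ₂) (delta2 η δ) (δ * delta2 η δ) := by
  have hr1 : 1 ≤ ρ₁ ^ 2 := one_le_pow₀ hρ₁
  have hr2 : ρ₂ ≤ ρ₁ ^ 2 := by nlinarith
  have hr3 : ρ₂ * ρ₂ ≤ ρ₁ ^ 2 := by nlinarith
  have hr4 : 3 * ρ₂ ≤ 3 + ρ₁ ^ 2 := by nlinarith [sq_nonneg (ρ₁ - 3 / 2)]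
  have hn0 : (0 : ℝ) < n := by positivity
  have hN : 0 < n * a := by positivity
  set δ₁ := delta1 η δ ρ₂ with hδ₁
  set δ₂ := delta2 η δ with hδ₂
  have d2 : 1 ≤ δ₂ := le_max_right _ _
  have hD : δ * δ₂ = max (16 * η) δ := by
    rw [hδ₂, delta2, mul_max_of_nonneg _ _ hδ.le, mul_one, mul_div_cancel₀ _ hδ.ne']
  have m1 : 12 * 2 ≤ δ₁ := mul_le_mul_of_nonneg_left (le_max_left _ _) (by norm_num)
  have m2 : 12 * (2 * ρ₂⁻¹ * η⁻¹) ≤ δ₁ :=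
    mul_le_mul_of_nonneg_left ((le_max_left _ _).trans (le_max_right _ _)) (by norm_num)
  have m3 : 12 * (δ₂ * deltaTilde δ) ≤ δ₁ :=
    mul_le_mul_of_nonneg_left ((le_max_right _ _).trans (le_max_right _ _)) (by norm_num)
  have dt := deltaTilde_ge_one δ
  have dl := deltaTilde_lower hδ hδ1
  have h24 : 24 ≤ δ₁ * (ρ₂ * η) := by
    have := mul_le_mul_of_nonneg_right m2 (by positivity : 0 ≤ ρ₂ * η)
    field_simp at this
    linarith
  have hΘ : 2 / ρ₂ * (1 + 2 * L + 8 * η * ρ₁ ^ 2 * ρ₂⁻¹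
      + δ₁ * (3 / 2 + 3 * L ^ 2 + η * ρ₁ + ρ₁ ^ 2 / 2)) ≤ θ := (le_max_right _ _).trans hθ
  have hΘ' : 2 + 4 * L + 16 * η * ρ₁ ^ 2 / ρ₂ + δ₁ * (3 + 6 * L ^ 2 + 2 * (η * ρ₁) + ρ₁ ^ 2)
      ≤ θ * ρ₂ := by
    have := mul_le_mul_of_nonneg_right hΘ hρ₂.le
    refine le_trans (le_of_eq ?_) this
    field_simp
    ring
  have p1 : 0 ≤ 16 * η * ρ₁ ^ 2 / ρ₂ := by positivity
  have p2 : 0 ≤ δ₁ * L ^ 2 := by positivity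
  have p3 : 0 ≤ δ₁ * (η * ρ₁) := by positivity
  have p4 : 0 ≤ δ₁ * ρ₁ ^ 2 := by positivity
  have hδ₁0 : 0 < δ₁ := by linarith
  have t2 : 3 * δ₁ ≤ θ * ρ₂ := by linarith
  have hθ0 : 0 < θ := by
    by_contra h
    have : θ * ρ₂ ≤ 0 := mul_nonpos_of_nonpos_of_nonneg (not_lt.mp h) hρ₂.le
    linarith
  have t4 : 2 * (δ₁ * η) ≤ θ := by
    have : 2 * (δ₁ * η) * ρ₂ ≤ θ * ρ₂ := by
      have : δ₁ * η * ρ₂ ≤ δ₁ * η * ρ₁ := mul_le_mul_of_nonneg_left hρ (by positivity)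
      linarith
    exact le_of_mul_le_mul_right this hρ₂
  have t5 : 3 * δ₁ ≤ θ := by
    have : 3 * δ₁ * ρ₂ ≤ θ * ρ₂ := by
      have : δ₁ * (3 * ρ₂) ≤ δ₁ * (3 + ρ₁ ^ 2) :=
        mul_le_mul_of_nonneg_left hr4 hδ₁0.le
      linarith
    exact le_of_mul_le_mul_right this hρ₂
  have t5' : δ₁ * ρ₂ ≤ θ := by
    have : δ₁ * ρ₂ * ρ₂ ≤ θ * ρ₂ := by
      have : δ₁ * (ρ₂ * ρ₂) ≤ δ₁ * ρ₁ ^ 2 :=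
        mul_le_mul_of_nonneg_left hr3 hδ₁0.le
      linarith
    exact le_of_mul_le_mul_right this hρ₂
  have hDθ : δ₁ * (δ * δ₂) ≤ 8 * θ := by
    rw [hD]
    rcases max_cases (16 * η) δ with h | h
    · rw [h.1]; linarith
    · rw [h.1]
      have := mul_le_mul_of_nonneg_left hδ1 hδ₁0.le
      linarith
  have hDθρ : δ₁ * (δ * δ₂) ≤ 8 * (θ * ρ₂) := by
    rw [hD]
    rcases max_cases (16 * η) δ with h | h
    · rw [h.1]
      have : δ₁ * η * 1 ≤ δ₁ * η * ρ₁ := mul_le_mul_of_nonneg_left hρ₁ (by positivity)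
      linarith
    · rw [h.1]
      have := mul_le_mul_of_nonneg_left hδ1 hδ₁0.le
      linarith
  have hDη : δ * δ₂ ≤ η * θ := by
    rw [hD]
    refine max_le ?_ ?_
    · have : η * 16 ≤ η * θ := mul_le_mul_of_nonneg_left (by linarith) hη.le
      linarith
    have : η * (δ₁ * ρ₂) ≤ η * θ := mul_le_mul_of_nonneg_left t5' hη.le
    linarith
  have hD0 : 0 < δ * δ₂ := by positivity
  set D := δ * δ₂ with hDdef
  have ub : ∀ m r : ℝ, 0 < r → α ≤ D / (320 * θ ^ 2) * (m / r) → α * (r * θ ^ 2) ≤ m * (D / 320) := by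
    intro m r hr h
    have := mul_le_mul_of_nonneg_right h (by positivity : 0 ≤ r * θ ^ 2)
    refine this.trans (le_of_eq ?_)
    field_simp
  have hub : α ≤ D / (320 * θ ^ 2) *
    min (1 / M ^ 2) (min (n * a / M ^ 2) (min (1 / ρ₁ ^ 2) (1 / (n * a)))) := by
    rw [hD]; exact hαub
  have hc : 0 ≤ D / (320 * θ ^ 2) := by positivity
  have u1 := ub 1 (M ^ 2) (by positivity)
    (hub.trans (mul_le_mul_of_nonneg_left (min_le_left _ _) hc))
  have u2 := ub (n * a) (M ^ 2) (by positivity)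
    (hub.trans (mul_le_mul_of_nonneg_left ((min_le_right _ _).trans (min_le_left _ _)) hc))
  have u3 := ub 1 (ρ₁ ^ 2) (by positivity)
    (hub.trans (mul_le_mul_of_nonneg_left ((min_le_right _ _).trans
      ((min_le_right _ _).trans (min_le_left _ _))) hc))
  have u4 := ub 1 (n * a) (by positivity)
    (hub.trans (mul_le_mul_of_nonneg_left ((min_le_right _ _).trans
      ((min_le_right _ _).trans (min_le_right _ _))) hc))
  have hDle : D ≤ θ := by
    have := mul_le_mul_of_nonneg_right m1 hD0.le
    linarith
  have u5 : α * θ ^ 2 ≤ D / 320 := by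
    have : α * θ ^ 2 * 1 ≤ α * θ ^ 2 * ρ₁ ^ 2 :=
      mul_le_mul_of_nonneg_left hr1 (by positivity)
    linarith
  have u6 : α * (θ * ρ₂) ≤ 1 / 320 := by
    have h1 : α * θ * (θ * ρ₂) ≤ θ * (1 / 320) := by
      have : α * θ ^ 2 * ρ₂ ≤ α * θ ^ 2 * ρ₁ ^ 2 :=
        mul_le_mul_of_nonneg_left hr2 (by positivity)
      linarith
    have h2 : θ * (α * (θ * ρ₂)) ≤ θ * (1 / 320) := by linarith
    exact le_of_mul_le_mul_left h2 hθ0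
  have tL : 4 * L ≤ θ * ρ₂ := by linarith
  have tL2 : 6 * (δ₁ * L ^ 2) ≤ θ * ρ₂ := by linarith
  refine
    { L_nonneg := hL, ρ₂_pos := hρ₂, η_pos := hη, α_pos := hα, N_pos := hN, D_pos := hD0
      one_le_M := hM, δ₁_ge := by linarith, δ₁_mul_ge := h24, δ₁_mul_D_ge := ?_
      δ₂_ge := d2, δ₂_le := ?_, L_le := tL, δ₁_le := t2, L_sq_le := tL2, δ₁_mul_η_le := t4
      θ_ge := by linarith, δ₁_le_θ := t5, D_le := hDle, D_le_mul := hDη, δ₁_mul_D_le := hDθρ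
      α_mul_M := by linear_combination u1, α_mul_M_N := by linear_combination u2
      α_mul_N := by linear_combination u4
      α_le := u5, α_mul_δ₁ := ?_, α_mul_L_sq := ?_, α_mul_L := ?_ }
  -- `18/5 = 12 · 3/10`, from `δ₁ ≥ 12 δ₂ δ̃`, `D = δδ₂`, `δ₂ ≥ 1` and `deltaTilde_lower`.
  · have h1 : 12 * (δ₂ * deltaTilde δ) * D ≤ δ₁ * D := mul_le_mul_of_nonneg_right m3 hD0.le
    have h2 : 12 * (δ₂ * deltaTilde δ) * D = 12 * (δ₂ * δ₂) * (δ * deltaTilde δ) := by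
      rw [hDdef]; ring
    have h3 : 12 * 1 * (3 / 10) ≤ 12 * (δ₂ * δ₂) * (δ * deltaTilde δ) :=
      mul_le_mul (mul_le_mul_of_nonneg_left (one_le_mul_of_one_le_of_one_le d2 d2) (by norm_num)) dl
        (by norm_num) (by positivity)
    linarith
  · have := mul_le_mul_of_nonneg_left dt (by positivity : 0 ≤ δ₂)
    linarith
  -- `2880 = 320 · 72 / 8`, from `αθ² ≤ D/320`, `δ₁D ≤ 8θ` and `θ ≥ 72`.
  · have h1 : θ ^ 2 * (α * δ₁) ≤ θ ^ 2 * (1 / 2880) := by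
      have : δ₁ * (α * θ ^ 2) ≤ δ₁ * (D / 320) := mul_le_mul_of_nonneg_left u5 hδ₁0.le
      linarith [mul_le_mul_of_nonneg_right (by linarith : (72 : ℝ) ≤ θ) hθ0.le]
    exact le_of_mul_le_mul_left h1 (by positivity)
  · have := mul_le_mul_of_nonneg_left tL2 hα.le
    linarith
  · have := mul_le_mul_of_nonneg_left tL hα.le
    linarith

namespace StepSizes

variable {L ρ₂ η θ α M N δ₁ δ₂ D : ℝ}

theorem θ_pos (h : StepSizes L ρ₂ η θ α M N δ₁ δ₂ D) : 0 < θ := by linarith [h.θ_ge]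

theorem δ₁_pos (h : StepSizes L ρ₂ η θ α M N δ₁ δ₂ D) : 0 < δ₁ := by linarith [h.δ₁_ge]

theorem M_pos (h : StepSizes L ρ₂ η θ α M N δ₁ δ₂ D) : 0 < M := by linarith [h.one_le_M]

theorem ge_of_θρ₂ (h : StepSizes L ρ₂ η θ α M N δ₁ δ₂ D) : 72 ≤ θ * ρ₂ := by
  linarith [h.δ₁_le, h.δ₁_ge]

theorem sq_le_consensus (h : StepSizes L ρ₂ η θ α M N δ₁ δ₂ D) :
    δ₁ * (α * (θ * M)) ^ 2 ≤ α * (θ * ρ₂) / 40 := by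
  have h1 := mul_le_mul_of_nonneg_left h.α_mul_M (mul_pos h.δ₁_pos h.α_pos).le
  have h2 := mul_le_mul_of_nonneg_left h.δ₁_mul_D_le h.α_pos.le
  linarith

theorem sq_le_compression (h : StepSizes L ρ₂ η θ α M N δ₁ δ₂ D) :
    δ₁ * (α * (θ * M)) ^ 2 ≤ D / 921600 := by
  have h1 := mul_le_mul_of_nonneg_left h.α_mul_M (mul_pos h.δ₁_pos h.α_pos).le
  have h2 := mul_le_mul_of_nonneg_right h.α_mul_δ₁ h.D_pos.le
  linarith

theorem α_le_consensus (h : StepSizes L ρ₂ η θ α M N δ₁ δ₂ D) : α ≤ α * (θ * ρ₂) / 72 := by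
  linarith [mul_le_mul_of_nonneg_left h.ge_of_θρ₂ h.α_pos.le]

theorem α_le_compression (h : StepSizes L ρ₂ η θ α M N δ₁ δ₂ D) : α ≤ D / 1658880 := by
  have h1 : (72 : ℝ) ^ 2 ≤ θ ^ 2 := pow_le_pow_left₀ (by norm_num) h.θ_ge 2
  linarith [mul_le_mul_of_nonneg_left h1 h.α_pos.le, h.α_le]

theorem L_sq_le_consensus (h : StepSizes L ρ₂ η θ α M N δ₁ δ₂ D) :
    δ₁ * (α * L) ^ 2 ≤ α * (θ * ρ₂) / 138240 := by
  have h1 := mul_le_mul_of_nonneg_left h.α_mul_L_sq h.α_pos.le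
  linarith [h.α_le_consensus]

theorem η_le (h : StepSizes L ρ₂ η θ α M N δ₁ δ₂ D) : 48 * η ≤ θ := by
  linarith [h.δ₁_mul_η_le, mul_le_mul_of_nonneg_right h.δ₁_ge h.η_pos.le]

end StepSizes

/-! ### One-step descent in an abstract inner product space. -/

section Consensus

variable {H : Type*} [NormedAddCommGroup H] [InnerProductSpace ℝ H]

theorem mul_inner_le {c k : ℝ} (h : |c| ≤ k) (a b : H) :
    c * inner ℝ a b ≤ k * (‖a‖ * ‖b‖) :=
  calc c * inner ℝ a b ≤ |c * inner ℝ a b| := le_abs_self _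
    _ = |c| * |inner ℝ a b| := abs_mul _ _
    _ ≤ k * (‖a‖ * ‖b‖) :=
      mul_le_mul h (abs_real_inner_le_norm a b) (abs_nonneg _) ((abs_nonneg _).trans h)

/-- The total weight of the squared variation of the gradients in the consensus descent. -/
def gradientWeight (ρ₂ η θ α δ₁ : ℝ) : ℝ :=
  4 / 3 * (ρ₂ * η)⁻¹ + 2 * α + α * (ρ₂ * η)⁻¹ + 9 * δ₁ * (α * θ / η) ^ 2
    + 8 / 5 * (δ₁ * θ * α ^ 2 / η) + δ₁ * α + 8 * δ₁ * α ^ 2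

/-- Because `R` inverts `B` on `x` and `e`, the `R`-weighted term contributes `2⟨v, x⟩`, which
cancels the `-2⟨x, v⟩` coming from `‖x‖²`. The value of `c` removes the `δ₁` part of the coefficient
of `⟨v, Bx⟩`. The summand `δ₁/12 ‖y - v‖²` is added in advance to pay for the movement term of the
compression error. -/
theorem consensus_identity (B R : H →ₗ[ℝ] H)
    (Rsymm : ∀ y z, inner ℝ (R y) z = inner ℝ y (R z))
    (x v e u w h y z : H) (RBx : R (B x) = x) (RBe : R (B e) = e) {η θ α M δ₁ δ₂ c : ℝ}
    (hη : η ≠ 0) (hα : α ≠ 0) (hc : c = δ₁ / 2 * (θ + η) - θ - δ₂ * θ)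
    (hh : h = (α * θ) • (M • e - B e) - α • u) (hy : y = h - (α * θ) • B x)
    (hz : z = η • B (x + e) + w) :
    1 / (η * α) * (inner ℝ (v + α • z) (R (v + α • z)) - inner ℝ v (R v))
      + c / η * (‖v + α • z‖ ^ 2 - ‖v‖ ^ 2) + (‖x + (y - v)‖ ^ 2 - ‖x‖ ^ 2)
      + δ₁ * (inner ℝ (x + (y - v)) (v + α • z) - inner ℝ x v) + δ₁ / 12 * ‖y - v‖ ^ 2
    = -(2 * α * (1 + δ₂) * θ) * inner ℝ v (B x)
      + α * (δ₁ - 2 * (1 + δ₂)) * θ * inner ℝ v (B e)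
      + 2 * inner ℝ v e + 2 / η * inner ℝ v (R w)
      + α * η * inner ℝ (x + e) (B (x + e)) + 2 * α * inner ℝ (x + e) w
      + α / η * inner ℝ w (R w) + 2 * α * c / η * inner ℝ v w + c / η * α ^ 2 * ‖z‖ ^ 2
      + (-(2 * (α * θ)) * inner ℝ x (B x) + -(2 * α) * inner ℝ x u
        + 2 * α * θ * inner ℝ x (M • e - B e))
      + (1 + δ₁ / 12) * ‖y - v‖ ^ 2
      + δ₁ * α * (η * inner ℝ x (B x) + η * inner ℝ x (B e) + inner ℝ x w)
      + δ₁ * inner ℝ h v + δ₁ * α * inner ℝ y z - δ₁ * α * inner ℝ v w - δ₁ * ‖v‖ ^ 2 := by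
  have hRz : R z = η • (x + e) + R w := by
    rw [hz]; simp [map_add, map_smul, RBx, RBe]
  have n1 : ‖v + α • z‖ ^ 2 = ‖v‖ ^ 2 + 2 * α * inner ℝ v z + α ^ 2 * ‖z‖ ^ 2 := by
    rw [norm_add_sq_real, inner_smul_right, norm_smul, mul_pow, Real.norm_eq_abs, sq_abs]; ring
  have n2 : ‖x + (y - v)‖ ^ 2 = ‖x‖ ^ 2 + 2 * (inner ℝ x y - inner ℝ x v) + ‖y - v‖ ^ 2 := by
    rw [norm_add_sq_real, inner_sub_right]
  have n3 : inner ℝ (v + α • z) (R (v + α • z)) = inner ℝ v (R v) + 2 * α * inner ℝ v (R z)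
      + α ^ 2 * inner ℝ z (R z) := by
    have : inner ℝ z (R v) = inner ℝ v (R z) := by rw [← Rsymm, real_inner_comm]
    simp only [map_add, map_smul, inner_add_left, inner_add_right, inner_smul_left,
      inner_smul_right, this, RCLike.conj_to_real]
    ring
  have n4 : inner ℝ (x + (y - v)) (v + α • z) = inner ℝ x v + α * inner ℝ x z + inner ℝ y v
      + α * inner ℝ y z - ‖v‖ ^ 2 - α * inner ℝ v z := by
    simp only [inner_add_left, inner_add_right, inner_sub_left, inner_smul_right,
      real_inner_self_eq_norm_sq]
    ring
  have n5 : inner ℝ v (R z) = η * inner ℝ v x + η * inner ℝ v e + inner ℝ v (R w) := by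
    rw [hRz]; simp only [inner_add_right, inner_smul_right]; ring
  have n6 : inner ℝ z (R z) = η ^ 2 * inner ℝ (x + e) (B (x + e)) + 2 * η * inner ℝ (x + e) w
      + inner ℝ w (R w) := by
    have h1 : inner ℝ (B (x + e)) (R w) = inner ℝ (x + e) w := by
      rw [← Rsymm, map_add B, map_add R, RBx, RBe]
    have h2 : inner ℝ (B (x + e)) (x + e) = inner ℝ (x + e) (B (x + e)) := real_inner_comm _ _
    have h3 : inner ℝ w (x + e) = inner ℝ (x + e) w := real_inner_comm _ _
    rw [hRz, hz, inner_add_left, inner_add_right, inner_add_right, inner_smul_left,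
      inner_smul_left, inner_smul_right, inner_smul_right, h1, h2, h3]
    simp only [RCLike.conj_to_real]
    ring
  have n7 : ∀ a, inner ℝ a z = η * inner ℝ a (B x) + η * inner ℝ a (B e) + inner ℝ a w := by
    intro a; rw [hz, map_add]; simp only [inner_add_right, inner_smul_right]; ring
  have n8 : inner ℝ y v = inner ℝ h v - α * θ * inner ℝ v (B x) := by
    rw [hy, inner_sub_left, inner_smul_left, real_inner_comm]; simp [real_inner_comm]
  have n9 : inner ℝ x y = α * θ * inner ℝ x (M • e - B e) - α * inner ℝ x u
      - α * θ * inner ℝ x (B x) := by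
    rw [hy, hh, inner_sub_right, inner_sub_right, inner_smul_right, inner_smul_right,
      inner_smul_right]
  rw [n1, n2, n3, n4, n5, n6, n8, n9, n7 v, n7 x, real_inner_comm x v, hc]
  field_simp
  ring

end Consensus

section Consensus

variable {H : Type*} [NormedAddCommGroup H] [InnerProductSpace ℝ H]

theorem inner_add_map_add_le (B : H →ₗ[ℝ] H) (Bpsd : ∀ y, 0 ≤ inner ℝ y (B y)) (x e : H) :
    inner ℝ (x + e) (B (x + e)) ≤ 2 * inner ℝ x (B x) + 2 * inner ℝ e (B e) := by
  have := Bpsd (x - e)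
  simp only [map_add, map_sub, inner_add_left, inner_add_right, inner_sub_left,
    inner_sub_right] at this ⊢
  linarith

-- Each term of `consensus_identity` is split by Young's inequality into multiples of `δ₁‖v‖²`, `P`,
-- `q` and `‖w‖²`. The shares of `δ₁‖v‖²` are six times `1/32`, plus `1/4` and `25/54`, which is
-- below the available `1`. The shares of `q` stay below `5/8`, and those of `‖w‖²` add up to
-- `gradientWeight`.
set_option maxHeartbeats 4000000 in
theorem consensus_descent (B R : H →ₗ[ℝ] H)
    (Rsymm : ∀ y z, inner ℝ (R y) z = inner ℝ y (R z))
    (Bpsd : ∀ y, 0 ≤ inner ℝ y (B y))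
    (x v e u w h y z : H) (RBx : R (B x) = x) (RBe : R (B e) = e)
    {L ρ₂ η θ α M N δ₁ δ₂ D c : ℝ} (S : StepSizes L ρ₂ η θ α M N δ₁ δ₂ D)
    (Bnorm : ∀ y, ‖B y‖ ≤ M * ‖y‖) (Rnorm : ∀ y, ρ₂ * ‖R y‖ ≤ ‖y‖)
    (hMB : ∀ y, ‖M • y - B y‖ ≤ 2 * (M * ‖y‖))
    (Bx : ρ₂ * ‖x‖ ^ 2 ≤ inner ℝ x (B x)) (hu : ‖u‖ ≤ L * ‖x‖)
    (hc : c = δ₁ / 2 * (θ + η) - θ - δ₂ * θ)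
    (hh : h = (α * θ) • (M • e - B e) - α • u) (hy : y = h - (α * θ) • B x)
    (hz : z = η • B (x + e) + w) :
    1 / (η * α) * (inner ℝ (v + α • z) (R (v + α • z)) - inner ℝ v (R v))
      + c / η * (‖v + α • z‖ ^ 2 - ‖v‖ ^ 2) + (‖x + (y - v)‖ ^ 2 - ‖x‖ ^ 2)
      + δ₁ * (inner ℝ (x + (y - v)) (v + α • z) - inner ℝ x v) + δ₁ / 12 * ‖y - v‖ ^ 2
    ≤ -(1 / 2) * (α * (θ * ρ₂) * ‖x‖ ^ 2) + 5 / 8 * (D * ‖e‖ ^ 2)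
      + gradientWeight ρ₂ η θ α δ₁ * ‖w‖ ^ 2 := by
  have hη := S.η_pos
  have hα := S.α_pos
  have hθ := S.θ_pos
  have hδ₁ := S.δ₁_pos
  have hM := S.M_pos
  have hρ₂ := S.ρ₂_pos
  have hδ₂ := S.δ₂_ge
  have hL := S.L_nonneg
  rw [consensus_identity B R Rsymm x v e u w h y z RBx RBe hη.ne' hα.ne' hc hh hy hz]
  have hX0 := norm_nonneg x
  have hV0 := norm_nonneg v
  have hE0 := norm_nonneg e
  have hW0 := norm_nonneg w
  have hY0 := norm_nonneg y
  have bx := Bnorm x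
  have be := Bnorm e
  have bxe : ‖B (x + e)‖ ≤ M * (‖x‖ + ‖e‖) := by
    rw [map_add]; linarith [norm_add_le (B x) (B e)]
  have rw' : ‖R w‖ ≤ ρ₂⁻¹ * ‖w‖ := by
    rw [inv_mul_eq_div, le_div_iff₀ hρ₂, mul_comm]; exact Rnorm w
  have mbe := hMB e
  generalize hXdef : ‖x‖ = X at *
  generalize hVdef : ‖v‖ = V at *
  generalize hEdef : ‖e‖ = E at *
  generalize hWdef : ‖w‖ = W at *
  generalize hYdef : ‖y‖ = Y at *
  have c4 : 1 + δ₂ ≤ δ₁ / 8 := by linarith [S.δ₂_le, S.δ₁_ge]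
  have c0 : 0 ≤ c := by
    rw [hc]; nlinarith
  have cub : c ≤ 49 / 96 * (δ₁ * θ) := by
    rw [hc]; nlinarith [S.η_le]
  obtain ⟨σ, hσ⟩ : ∃ σ, σ = θ * M := ⟨_, rfl⟩
  have hσ0 : 0 ≤ σ := by rw [hσ]; positivity
  have F1 := S.sq_le_consensus
  have F2 := S.sq_le_compression
  have F3 := S.L_sq_le_consensus
  have F4 := S.α_le_consensus
  have F5 := S.α_le_compression
  have F6 := S.α_mul_M
  rw [← hσ] at F1 F2 F6
  -- `P` is the unit of consensus gain and `q` the unit of compression loss.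
  obtain ⟨P, hP⟩ : ∃ P, P = α * (θ * ρ₂) * X ^ 2 := ⟨_, rfl⟩
  obtain ⟨q, hq⟩ : ∃ q, q = D * E ^ 2 := ⟨_, rfl⟩
  have G1 : δ₁ * (α * σ * X) ^ 2 ≤ P / 40 := by
    rw [hP]; linarith [mul_le_mul_of_nonneg_right F1 (sq_nonneg X)]
  have G2 : δ₁ * (α * σ * E) ^ 2 ≤ q / 921600 := by
    rw [hq]; linarith [mul_le_mul_of_nonneg_right F2 (sq_nonneg E)]
  have G3 : δ₁ * (α * L * X) ^ 2 ≤ P / 138240 := by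
    rw [hP]; linarith [mul_le_mul_of_nonneg_right F3 (sq_nonneg X)]
  have G4 : α * X ^ 2 ≤ P / 72 := by
    rw [hP]; linarith [mul_le_mul_of_nonneg_right F4 (sq_nonneg X)]
  have G5 : α * E ^ 2 ≤ q / 1658880 := by
    rw [hq]; linarith [mul_le_mul_of_nonneg_right F5 (sq_nonneg E)]
  have G6 : α * (σ * E) ^ 2 ≤ q / 320 := by
    rw [hq]; linarith [mul_le_mul_of_nonneg_right F6 (sq_nonneg E)]
  have hP0 : 0 ≤ P := by rw [hP]; positivity
  have hq0 : 0 ≤ q := by rw [hq]; have := S.D_pos; positivity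
  have G7 : α * (σ * (X * E)) ≤ α * X ^ 2 / 4 + q / 320 := by
    have := mul_nonneg hα.le (sq_nonneg (X / 2 - σ * E))
    linarith
  have hXB : P ≤ α * θ * inner ℝ x (B x) := by
    rw [hP]; linarith [mul_le_mul_of_nonneg_left Bx (by positivity : 0 ≤ α * θ)]
  have hYle : Y ≤ α * σ * X + α * L * X + 2 * (α * σ * E) := by
    have hn : ‖y‖ ≤ ‖(α * θ) • (M • e - B e)‖ + ‖α • u‖ + ‖(α * θ) • B x‖ := by
      rw [hy, hh]
      exact (norm_sub_le _ _).trans (add_le_add_left (norm_sub_le _ _) _)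
    rw [norm_smul, norm_smul, norm_smul, Real.norm_of_nonneg hα.le,
      Real.norm_of_nonneg (by positivity : 0 ≤ α * θ), hYdef] at hn
    have k1 := mul_le_mul_of_nonneg_left mbe (by positivity : 0 ≤ α * θ)
    have k2 := mul_le_mul_of_nonneg_left bx (by positivity : 0 ≤ α * θ)
    have k3 := mul_le_mul_of_nonneg_left hu hα.le
    rw [hσ]; linarith
  have hhle : ‖h‖ ≤ α * L * X + 2 * (α * σ * E) := by
    have hn : ‖h‖ ≤ ‖(α * θ) • (M • e - B e)‖ + ‖α • u‖ := by
      rw [hh]; exact norm_sub_le _ _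
    rw [norm_smul, norm_smul, Real.norm_of_nonneg hα.le,
      Real.norm_of_nonneg (by positivity : 0 ≤ α * θ)] at hn
    have k1 := mul_le_mul_of_nonneg_left mbe (by positivity : 0 ≤ α * θ)
    have k3 := mul_le_mul_of_nonneg_left hu hα.le
    rw [hσ]; linarith
  have fY : δ₁ * Y ^ 2 ≤ P / 13 + q / 70000 := by
    have h1 : Y ^ 2 ≤ 3 * ((α * σ * X) ^ 2 + (α * L * X) ^ 2 + 4 * (α * σ * E) ^ 2) := by
      refine (pow_le_pow_left₀ hY0 hYle 2).trans ?_
      linarith [sq_nonneg (α * σ * X - α * L * X), sq_nonneg (α * σ * X - 2 * (α * σ * E)),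
        sq_nonneg (α * L * X - 2 * (α * σ * E))]
    have h2 := mul_le_mul_of_nonneg_left h1 hδ₁.le
    linarith
  have fh : δ₁ * ‖h‖ ^ 2 ≤ P / 69120 + q / 115200 := by
    have h1 : ‖h‖ ^ 2 ≤ 2 * ((α * L * X) ^ 2 + 4 * (α * σ * E) ^ 2) := by
      refine (pow_le_pow_left₀ (norm_nonneg _) hhle 2).trans ?_
      linarith [sq_nonneg (α * L * X - 2 * (α * σ * E))]
    have h2 := mul_le_mul_of_nonneg_left h1 hδ₁.le
    linarith
  have fzle : ‖z‖ ≤ η * (M * (X + E)) + W := by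
    rw [hz, ← hWdef]
    refine (norm_add_le _ _).trans (add_le_add_left ?_ _)
    rw [norm_smul, Real.norm_of_nonneg hη.le]
    exact mul_le_mul_of_nonneg_left bxe hη.le
  have ησ : δ₁ * (η * M) ≤ σ / 2 := by
    rw [hσ]; linarith [mul_le_mul_of_nonneg_right S.δ₁_mul_η_le hM.le]
  have ta : -(2 * α * (1 + δ₂) * θ) * inner ℝ v (B x) ≤ δ₁ * V ^ 2 / 32 + P / 80 := by
    have h1 : |-(2 * α * (1 + δ₂) * θ)| ≤ δ₁ / 4 * (α * θ) := by
      rw [abs_neg, abs_of_nonneg (by positivity)]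
      linarith [mul_le_mul_of_nonneg_left c4 (by positivity : 0 ≤ 2 * (α * θ))]
    have h2 := mul_inner_le h1 v (B x)
    have h3 := mul_le_mul_of_nonneg_left bx (by positivity : 0 ≤ δ₁ / 4 * (α * θ) * V)
    have h4 := mul_nonneg hδ₁.le (sq_nonneg (V - 4 * (α * σ * X)))
    rw [hVdef] at h2
    rw [hσ] at h4 G1
    linarith
  have tb : α * (δ₁ - 2 * (1 + δ₂)) * θ * inner ℝ v (B e) ≤ δ₁ * V ^ 2 / 32 + q / 115200 := by
    have h1 : |α * (δ₁ - 2 * (1 + δ₂)) * θ| ≤ δ₁ * (α * θ) := by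
      rw [abs_of_nonneg (mul_nonneg (mul_nonneg hα.le (by linarith)) hθ.le)]
      linarith [mul_le_mul_of_nonneg_left (by linarith : 0 ≤ 2 * (1 + δ₂))
        (by positivity : 0 ≤ (α * θ))]
    have h2 := mul_inner_le h1 v (B e)
    have h3 := mul_le_mul_of_nonneg_left be (by positivity : 0 ≤ δ₁ * (α * θ) * V)
    have h4 := mul_nonneg hδ₁.le (sq_nonneg (V - 16 * (α * σ * E)))
    rw [hVdef] at h2
    rw [hσ] at h4 G2
    linarith
  -- This coupling carries no factor `α`, so small steps do not help. Only `δ₁D ≥ 18/5` controls it,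
  -- and it uses the largest shares of `δ₁‖v‖²` and `q`: `25/54 = (5/3)(5/18)`.
  have tc : 2 * inner ℝ v e ≤ 25 / 54 * (δ₁ * V ^ 2) + 3 / 5 * q := by
    have h2 := real_inner_le_norm v e
    rw [hVdef, hEdef] at h2
    have hD := S.D_pos
    have h3 := mul_le_mul_of_nonneg_right S.δ₁_mul_D_ge (sq_nonneg V)
    have h4 : 2 * (V * E) * D ≤ (25 / 54 * (δ₁ * V ^ 2) + 3 / 5 * q) * D := by
      rw [hq]; linarith [sq_nonneg (3 / 5 * (D * E) - V)]
    linarith [le_of_mul_le_mul_right h4 hD]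
  have td : 2 / η * inner ℝ v (R w)
      ≤ δ₁ * V ^ 2 / 32 + 4 / 3 * (ρ₂ * η)⁻¹ * W ^ 2 := by
    have h2 := mul_inner_le (abs_of_nonneg (by positivity : 0 ≤ 2 / η)).le v (R w)
    have h3 := mul_le_mul_of_nonneg_left rw' (by positivity : 0 ≤ 2 / η * V)
    rw [hVdef] at h2
    obtain ⟨p, hp⟩ : ∃ p, p = (ρ₂ * η)⁻¹ := ⟨_, rfl⟩
    have hp0 : 0 < p := by rw [hp]; positivity
    have e1 : 2 / η * V * (ρ₂⁻¹ * W) = 2 * p * (V * W) := by rw [hp]; field_simp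
    have hδp : 24 * p ≤ δ₁ := by
      have := mul_le_mul_of_nonneg_right S.δ₁_mul_ge hp0.le
      rwa [mul_assoc, hp, mul_inv_cancel₀ (by positivity), mul_one, ← hp] at this
    have h4 := mul_nonneg hp0.le (sq_nonneg (3 * V - 4 * W))
    have h5 := mul_le_mul_of_nonneg_right hδp (sq_nonneg V)
    rw [← hp]
    linarith
  have te : α * η * inner ℝ (x + e) (B (x + e))
      ≤ α * θ * inner ℝ x (B x) / 24 + q / 100000 := by
    have h1 : inner ℝ (x + e) (B (x + e)) ≤ 2 * inner ℝ x (B x) + 2 * inner ℝ e (B e) :=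
      inner_add_map_add_le B Bpsd x e
    have h2 := real_inner_le_norm e (B e)
    rw [hEdef] at h2
    have h3 := mul_le_mul_of_nonneg_left be hE0
    have h4 := mul_le_mul_of_nonneg_left h1 (by positivity : 0 ≤ α * η)
    have h5 := mul_le_mul_of_nonneg_left S.η_le (mul_nonneg hα.le (Bpsd x))
    have h6 : α * η * (M * E ^ 2) ≤ q / 1000000 := by
      have k1 : 48 * η * M * 72 ≤ σ ^ 2 := by
        rw [hσ, mul_pow, sq]
        have : 48 * η * 72 * M ≤ θ * θ * (M * M) :=
          mul_le_mul (mul_le_mul S.η_le S.θ_ge (by norm_num) hθ.le)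
            (le_mul_of_one_le_left hM.le S.one_le_M) hM.le (by positivity)
        linarith
      have k2 := mul_le_mul_of_nonneg_left k1 (by positivity : 0 ≤ α * E ^ 2)
      linarith
    have h7 := mul_le_mul_of_nonneg_left (h2.trans h3) (by positivity : 0 ≤ α * η)
    linarith
  have tf : 2 * α * inner ℝ (x + e) w ≤ P / 72 + q / 1000000 + 2 * α * W ^ 2 := by
    have h2 := mul_inner_le (abs_of_nonneg (by positivity : 0 ≤ 2 * α)).le (x + e) w
    have h3 : ‖x + e‖ ≤ X + E := by rw [← hXdef, ← hEdef]; exact norm_add_le _ _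
    have h4 := mul_le_mul_of_nonneg_left h3 (by positivity : 0 ≤ 2 * α * W)
    have h5 := mul_nonneg hα.le (sq_nonneg (X - W))
    have h6 := mul_nonneg hα.le (sq_nonneg (E - W))
    rw [hWdef] at h2
    linarith
  have tg : α / η * inner ℝ w (R w) ≤ α * (ρ₂ * η)⁻¹ * W ^ 2 := by
    have h2 := mul_inner_le (abs_of_nonneg (by positivity : 0 ≤ α / η)).le w (R w)
    have h3 := mul_le_mul_of_nonneg_left rw' (by positivity : 0 ≤ α / η * W)
    rw [hWdef] at h2
    have e1 : α / η * W * (ρ₂⁻¹ * W) = α * (ρ₂ * η)⁻¹ * W ^ 2 := by field_simp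
    linarith
  have th : 2 * α * c / η * inner ℝ v w
      ≤ δ₁ * V ^ 2 / 32 + 9 * δ₁ * (α * θ / η) ^ 2 * W ^ 2 := by
    have h1 : |2 * α * c / η| ≤ 49 / 48 * (δ₁ * (α * θ / η)) := by
      rw [abs_of_nonneg (by positivity)]
      have := mul_le_mul_of_nonneg_left cub (by positivity : 0 ≤ 2 * α / η)
      calc 2 * α * c / η = 2 * α / η * c := by ring
        _ ≤ _ := this
        _ = _ := by ring
    have h2 := mul_inner_le h1 v w
    rw [hVdef, hWdef] at h2
    have h4 := mul_nonneg hδ₁.le (sq_nonneg (V - 49 / 3 * (α * θ / η * W)))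
    have h5 := mul_nonneg hδ₁.le (sq_nonneg (α * θ / η * W))
    linarith
  have hz2 : ‖z‖ ^ 2 ≤ 3 * ((η * M * X) ^ 2 + (η * M * E) ^ 2 + W ^ 2) := by
    refine (pow_le_pow_left₀ (norm_nonneg _) fzle 2).trans ?_
    linarith [sq_nonneg (η * M * X - η * M * E), sq_nonneg (η * M * X - W),
      sq_nonneg (η * M * E - W)]
  have ti : c / η * α ^ 2 * ‖z‖ ^ 2
      ≤ P / 1000 + q / 921600 + 8 / 5 * (δ₁ * θ * α ^ 2 / η) * W ^ 2 := by
    have h1 : c / η * α ^ 2 ≤ 49 / 96 * (δ₁ * θ * α ^ 2 / η) := by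
      have := mul_le_mul_of_nonneg_right cub (by positivity : 0 ≤ α ^ 2 / η)
      calc c / η * α ^ 2 = c * (α ^ 2 / η) := by ring
        _ ≤ _ := this
        _ = _ := by ring
    have h2 : c / η * α ^ 2 * ‖z‖ ^ 2 ≤ 49 / 96 * (δ₁ * θ * α ^ 2 / η) *
        (3 * ((η * M * X) ^ 2 + (η * M * E) ^ 2 + W ^ 2)) :=
      mul_le_mul h1 hz2 (sq_nonneg _) (by positivity)
    have h3 : ∀ r, δ₁ * θ * α ^ 2 / η * (η * M * r) ^ 2 ≤ (α * σ * r) ^ 2 / 2 := by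
      intro r
      have e1 : δ₁ * θ * α ^ 2 / η * (η * M * r) ^ 2 = δ₁ * (η * M) * (α ^ 2 * r ^ 2 * σ) := by
        rw [hσ]; field_simp
      rw [e1]
      linarith [mul_le_mul_of_nonneg_right ησ (by positivity : 0 ≤ α ^ 2 * r ^ 2 * σ)]
    have h4 := h3 X
    have h5 := h3 E
    have h6 := mul_le_mul_of_nonneg_right S.δ₁_ge (sq_nonneg (α * σ * X))
    have h7 := mul_le_mul_of_nonneg_right S.δ₁_ge (sq_nonneg (α * σ * E))
    have h8 : 0 ≤ δ₁ * θ * α ^ 2 / η * W ^ 2 := by positivity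
    linarith
  -- The only source of negative consensus terms. Of `2αθ⟨x, Bx⟩`, the bounds `te` and `tl` consume
  -- `1/24` and `1/2`; the remaining `35/24` exceeds the sum of all `P` shares by more than `1/2`.
  have tj : -(2 * (α * θ)) * inner ℝ x (B x) + -(2 * α) * inner ℝ x u
        + 2 * α * θ * inner ℝ x (M • e - B e)
      ≤ -(2 * (α * θ)) * inner ℝ x (B x) + P / 2 + P / 72 + q / 80 := by
    have h1 : -(2 * α) * inner ℝ x u ≤ P / 2 := by
      have h2 := mul_inner_le (c := -(2 * α)) (k := 2 * α)
        (by rw [abs_neg, abs_of_nonneg (by positivity)]) x u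
      rw [hXdef] at h2
      have h3 := mul_le_mul_of_nonneg_left hu (by positivity : 0 ≤ 2 * α * X)
      have h4 := mul_le_mul_of_nonneg_left S.L_le (by positivity : 0 ≤ α * X ^ 2)
      rw [hP]; linarith
    have h2 : 2 * α * θ * inner ℝ x (M • e - B e) ≤ P / 72 + q / 80 := by
      have h2 := mul_inner_le (abs_of_nonneg (by positivity : 0 ≤ 2 * α * θ)).le x (M • e - B e)
      rw [hXdef] at h2
      have h3 := mul_le_mul_of_nonneg_left mbe (by positivity : 0 ≤ 2 * α * θ * X)
      rw [hσ] at G7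
      linarith
    linarith
  have tk : (1 + δ₁ / 12) * ‖y - v‖ ^ 2 ≤ δ₁ * V ^ 2 / 4 + P / 52 + q / 280000 := by
    have h1 : ‖y - v‖ ^ 2 ≤ 2 * Y ^ 2 + 2 * V ^ 2 := by
      have := norm_sub_le y v
      rw [hYdef, hVdef] at this
      linarith [pow_le_pow_left₀ (norm_nonneg _) this 2, sq_nonneg (Y - V)]
    have h2 : (1 + δ₁ / 12) * ‖y - v‖ ^ 2 ≤ δ₁ / 8 * (2 * Y ^ 2 + 2 * V ^ 2) :=
      mul_le_mul (by linarith [S.δ₁_ge]) h1 (sq_nonneg _) (by positivity)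
    linarith
  have tl : δ₁ * α * (η * inner ℝ x (B x) + η * inner ℝ x (B e) + inner ℝ x w)
      ≤ α * θ * inner ℝ x (B x) / 2 + P / 576 + q / 640 + P / 6 + δ₁ * α * W ^ 2 / 2 := by
    have h1 := mul_le_mul_of_nonneg_right S.δ₁_mul_η_le (mul_nonneg hα.le (Bpsd x))
    have h2 := mul_inner_le (abs_of_nonneg (by positivity : 0 ≤ δ₁ * α * η)).le x (B e)
    have h3 := mul_le_mul_of_nonneg_left be (by positivity : 0 ≤ δ₁ * α * η * X)
    have h4 := mul_le_mul_of_nonneg_right ησ (by positivity : 0 ≤ α * X * E)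
    have h5 := mul_inner_le (abs_of_nonneg (by positivity : 0 ≤ δ₁ * α)).le x w
    have h6 := mul_nonneg (by positivity : 0 ≤ δ₁ * α) (sq_nonneg (X - W))
    have h7 := mul_le_mul_of_nonneg_right S.δ₁_le (by positivity : 0 ≤ α * X ^ 2)
    rw [hXdef] at h2 h5
    rw [hWdef] at h5
    have h8 : δ₁ * α * X ^ 2 / 2 ≤ P / 6 := by rw [hP]; linarith
    linarith
  have tm : δ₁ * inner ℝ h v ≤ δ₁ * V ^ 2 / 32 + P / 8640 + q / 14400 := by
    have h2 := mul_le_mul_of_nonneg_left (real_inner_le_norm h v) hδ₁.le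
    rw [hVdef] at h2
    have h4 := mul_nonneg hδ₁.le (sq_nonneg (V - 16 * ‖h‖))
    linarith
  have h24Y := mul_le_mul_of_nonneg_right S.δ₁_ge (sq_nonneg Y)
  have tn : δ₁ * α * inner ℝ y z ≤ P / 300 + q / 100000 + δ₁ * α * W ^ 2 / 2 := by
    have h2 := mul_inner_le (abs_of_nonneg (by positivity : 0 ≤ δ₁ * α)).le y z
    rw [hYdef] at h2
    have h3 := mul_le_mul_of_nonneg_left fzle (by positivity : 0 ≤ δ₁ * α * Y)
    have h4 := mul_le_mul_of_nonneg_right ησ (by positivity : 0 ≤ α * Y * (X + E))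
    have h5 := mul_nonneg (by positivity : 0 ≤ δ₁ * α) (sq_nonneg (Y - W))
    have h6 := mul_le_mul_of_nonneg_right S.α_mul_δ₁ (sq_nonneg Y)
    have h7 := mul_le_mul_of_nonneg_right S.δ₁_ge (sq_nonneg (α * σ * X))
    have h8 := mul_le_mul_of_nonneg_right S.δ₁_ge (sq_nonneg (α * σ * E))
    have h9 := sq_nonneg (Y - α * σ * X)
    have h10 := sq_nonneg (Y - α * σ * E)
    linarith
  have tp : -(δ₁ * α * inner ℝ v w) ≤ δ₁ * V ^ 2 / 32 + 8 * δ₁ * α ^ 2 * W ^ 2 := by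
    have h2 := mul_inner_le (c := -(δ₁ * α)) (k := δ₁ * α)
      (by rw [abs_neg, abs_of_nonneg (by positivity)]) v w
    rw [hVdef, hWdef] at h2
    have h4 := mul_nonneg hδ₁.le (sq_nonneg (V - 16 * (α * W)))
    linarith
  have hV2 : 0 ≤ δ₁ * V ^ 2 := by positivity
  have hκ : gradientWeight ρ₂ η θ α δ₁ * W ^ 2 = 4 / 3 * (ρ₂ * η)⁻¹ * W ^ 2 + 2 * α * W ^ 2
      + α * (ρ₂ * η)⁻¹ * W ^ 2 + 9 * δ₁ * (α * θ / η) ^ 2 * W ^ 2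
      + 8 / 5 * (δ₁ * θ * α ^ 2 / η) * W ^ 2 + δ₁ * α * W ^ 2 + 8 * δ₁ * α ^ 2 * W ^ 2 := by
    rw [gradientWeight]; ring
  rw [hκ, ← hP, ← hq]
  linarith

end Consensus

/-- This is the condition under which all terms in `‖X̄' - X̄‖²` fit into `α/2 ‖g‖²` and a multiple
of the compression error. Each summand of `gradientWeight` is small separately, since `N = na` and
`L²` always meet enough powers of `α`. -/
theorem StepSizes.gradientWeight_le {L ρ₂ η θ α M N δ₁ δ₂ D : ℝ}
    (S : StepSizes L ρ₂ η θ α M N δ₁ δ₂ D) :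
    α * (L + 2 * N * (gradientWeight ρ₂ η θ α δ₁ * L ^ 2 + δ₁ / 12)) ≤ 1 / 2 := by
  have hη := S.η_pos
  have hα := S.α_pos
  have hθ := S.θ_pos
  have hδ₁ := S.δ₁_pos
  have hN := S.N_pos
  have hρ₂ := S.ρ₂_pos
  have hL := S.L_nonneg
  have a1 : N * α * θ ≤ η / 320 := by
    have : θ * (N * α * θ) ≤ θ * (η / 320) := by linarith [S.α_mul_N, S.D_le_mul]
    exact le_of_mul_le_mul_left this hθ
  have a2 : N * α * θ ≤ 1 / 320 := by
    have : θ * (N * α * θ) ≤ θ * (1 / 320) := by linarith [S.α_mul_N, S.D_le]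
    exact le_of_mul_le_mul_left this hθ
  have a3 : α * θ / η ≤ 1 / 320 := by
    rw [div_le_iff₀ hη]
    have : θ * (α * θ) ≤ θ * (1 / 320 * η) := by linarith [S.α_le, S.D_le_mul]
    exact le_of_mul_le_mul_left this hθ
  have a4 : N * α ≤ 1 / 100 := by
    linarith [mul_le_mul_of_nonneg_left S.θ_ge (mul_pos hN hα).le]
  have a5 : N * α * δ₁ ≤ 1 / 960 := by
    linarith [mul_le_mul_of_nonneg_left S.δ₁_le_θ (mul_pos hN hα).le]
  have a6 : α ≤ 1 / 2880 := by
    linarith [mul_le_mul_of_nonneg_left S.δ₁_ge hα.le, S.α_mul_δ₁]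
  have a7 : α * L ^ 2 ≤ 1 / 1920 := by
    have := mul_le_mul_of_nonneg_right S.δ₁_ge (by positivity : 0 ≤ α * L ^ 2)
    have : 0 ≤ α * L ^ 2 := by positivity
    linarith [S.α_mul_L_sq]
  have a8 := S.α_mul_L_sq
  -- Here `(ρ₂η)⁻¹` brings no further power of `α`: `6δ₁L² ≤ θρ₂` cancels `ρ₂` and `Nαθ ≤ η/320`
  -- cancels `η`.
  have q1 : N * α * L ^ 2 * (ρ₂ * η)⁻¹ ≤ 1 / 1920 := by
    rw [← div_eq_mul_inv, div_le_iff₀ (by positivity)]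
    have h1 := mul_le_mul_of_nonneg_right S.δ₁_ge (by positivity : 0 ≤ N * α * L ^ 2)
    have h2 := mul_le_mul_of_nonneg_left S.L_sq_le (mul_pos hN hα).le
    have h3 := mul_le_mul_of_nonneg_right a1 hρ₂.le
    have h4 : 0 ≤ N * α * L ^ 2 := by positivity
    linarith
  have q2 : N * α * L ^ 2 * α ≤ 1 / 1920 := by
    calc N * α * L ^ 2 * α = (N * α) * (α * L ^ 2) := by ring
      _ ≤ 1 * (1 / 1920) := mul_le_mul (by linarith) a7 (by positivity) (by norm_num)
      _ = _ := by norm_num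
  have q3 : N * α * L ^ 2 * (α * (ρ₂ * η)⁻¹) ≤ 1 / 1920 := by
    calc N * α * L ^ 2 * (α * (ρ₂ * η)⁻¹) = α * (N * α * L ^ 2 * (ρ₂ * η)⁻¹) := by ring
      _ ≤ 1 * (1 / 1920) := mul_le_mul (by linarith) q1 (by positivity) (by norm_num)
      _ = _ := by norm_num
  have q4 : N * α * L ^ 2 * (δ₁ * (α * θ / η) ^ 2) ≤ 1 / 1920 := by
    have a1' : N * α * θ / η ≤ 1 := by rw [div_le_one hη]; linarith
    calc N * α * L ^ 2 * (δ₁ * (α * θ / η) ^ 2)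
        = (α * (δ₁ * L ^ 2)) * ((α * θ / η) * (N * α * θ / η)) := by ring
      _ ≤ (1 / 1920) * (1 * 1) :=
        mul_le_mul a8 (mul_le_mul (by linarith) a1' (by positivity) (by norm_num))
          (by positivity) (by norm_num)
      _ = _ := by norm_num
  have q5 : N * α * L ^ 2 * (δ₁ * θ * α ^ 2 / η) ≤ 1 / 1920 := by
    calc N * α * L ^ 2 * (δ₁ * θ * α ^ 2 / η)
        = (α * (δ₁ * L ^ 2)) * ((α * θ / η) * (N * α)) := by ring
      _ ≤ (1 / 1920) * (1 * 1) :=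
        mul_le_mul a8 (mul_le_mul (by linarith) (by linarith) (by positivity) (by norm_num))
          (by positivity) (by norm_num)
      _ = _ := by norm_num
  have q6 : N * α * L ^ 2 * (δ₁ * α) ≤ 1 / 1920 := by
    calc N * α * L ^ 2 * (δ₁ * α) = (α * (δ₁ * L ^ 2)) * (N * α) := by ring
      _ ≤ (1 / 1920) * 1 := mul_le_mul a8 (by linarith) (by positivity) (by norm_num)
      _ = _ := by norm_num
  have q7 : N * α * L ^ 2 * (δ₁ * α ^ 2) ≤ 1 / 1920 := by
    calc N * α * L ^ 2 * (δ₁ * α ^ 2) = (α * (δ₁ * L ^ 2)) * ((N * α) * α) := by ring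
      _ ≤ (1 / 1920) * (1 * 1) :=
        mul_le_mul a8 (mul_le_mul (by linarith) (by linarith) (by positivity) (by norm_num))
          (by positivity) (by norm_num)
      _ = _ := by norm_num
  rw [gradientWeight]
  linarith [S.α_mul_L]

/-! ### Kronecker products as operators on stacked vectors. -/

section BlockOp

variable {n d : ℕ}

/-- Stacked vectors with the Euclidean norm of `ℝ^{nd}`. -/
abbrev Stack (n d : ℕ) : Type := PiLp 2 (fun _ : Fin n => Vec d)

/-- The linear operator `W ⊗ I_d` on stacked vectors. -/
def blockOp (W : Matrix (Fin n) (Fin n) ℝ) : Stack n d →ₗ[ℝ] Stack n d where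
  toFun Y := WithLp.toLp 2 (blockMul W Y.ofLp)
  map_add' X Y := by
    ext i k
    simp [blockMul, Finset.sum_add_distrib]
  map_smul' c X := by
    ext i k
    simp [blockMul, Finset.mul_sum, mul_left_comm]

theorem blockOp_apply (W : Matrix (Fin n) (Fin n) ℝ) (Y : Stack n d) (i : Fin n) :
    blockOp W Y i = ∑ j, W i j • Y j := rfl

theorem blockOp_toLp (W : Matrix (Fin n) (Fin n) ℝ) (X : Fin n → Vec d) :
    blockOp W (WithLp.toLp 2 X) = WithLp.toLp 2 (blockMul W X) := rfl

theorem blockOp_mul (A B : Matrix (Fin n) (Fin n) ℝ) (Y : Stack n d) :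
    blockOp (A * B) Y = blockOp A (blockOp B Y) := by
  ext i k
  simp only [blockOp_apply, Matrix.mul_apply, Finset.sum_smul, Finset.smul_sum, smul_smul]
  rw [Finset.sum_comm]

theorem blockOp_add (A B : Matrix (Fin n) (Fin n) ℝ) (Y : Stack n d) :
    blockOp (A + B) Y = blockOp A Y + blockOp B Y := by
  ext i k
  simp [blockOp_apply, add_mul, Finset.sum_add_distrib]

theorem blockOp_sub (A B : Matrix (Fin n) (Fin n) ℝ) (Y : Stack n d) :
    blockOp (A - B) Y = blockOp A Y - blockOp B Y := by
  ext i k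
  simp [blockOp_apply, sub_mul, Finset.sum_sub_distrib]

theorem blockOp_smul (c : ℝ) (A : Matrix (Fin n) (Fin n) ℝ) (Y : Stack n d) :
    blockOp (c • A) Y = c • blockOp A Y := by
  ext i k
  simp [blockOp_apply, Finset.mul_sum, mul_assoc]

theorem wInner_eq_inner (W : Matrix (Fin n) (Fin n) ℝ) (X Y : Fin n → Vec d) :
    wInner W X Y = inner ℝ (WithLp.toLp 2 X : Stack n d) (blockOp W (WithLp.toLp 2 Y)) := by
  rw [PiLp.inner_apply]; rfl

theorem stackNormSq_eq_norm_sq (X : Fin n → Vec d) :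
    stackNormSq X = ‖(WithLp.toLp 2 X : Stack n d)‖ ^ 2 := by
  rw [PiLp.norm_sq_eq_of_L2]; rfl

theorem blockOp_inner_left {W : Matrix (Fin n) (Fin n) ℝ} (hW : W.transpose = W)
    (X Y : Stack n d) : inner ℝ (blockOp W X) Y = inner ℝ X (blockOp W Y) := by
  simp only [PiLp.inner_apply, blockOp_apply, sum_inner, inner_sum, inner_smul_left,
    inner_smul_right, RCLike.conj_to_real]
  rw [Finset.sum_comm]
  refine Finset.sum_congr rfl fun i _ => Finset.sum_congr rfl fun j _ => ?_
  conv_lhs => rw [← hW, Matrix.transpose_apply]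

/-- The vector of the `k`-th coordinates of all blocks. -/
def coordStack (Y : Stack n d) (k : Fin d) : EuclideanSpace ℝ (Fin n) :=
  WithLp.toLp 2 fun i => Y i k

/-- Coordinatewise, `W ⊗ I_d` is `d` copies of `W`, so positivity and the operator norm bound
transfer from the matrix. -/
theorem inner_eq_sum_coordStack (X Y : Stack n d) :
    inner ℝ X Y = ∑ k, inner ℝ (coordStack X k) (coordStack Y k) := by
  simp only [PiLp.inner_apply, coordStack]
  rw [Finset.sum_comm]

theorem coordStack_blockOp (W : Matrix (Fin n) (Fin n) ℝ) (Y : Stack n d) (k : Fin d) :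
    coordStack (blockOp W Y) k = Matrix.toEuclideanCLM (𝕜 := ℝ) W (coordStack Y k) := by
  ext i
  simp [coordStack, blockOp_apply, Matrix.mulVec, dotProduct]

theorem inner_blockOp_nonneg {W : Matrix (Fin n) (Fin n) ℝ} (hW : W.PosSemidef)
    (Y : Stack n d) : 0 ≤ inner ℝ Y (blockOp W Y) := by
  rw [inner_eq_sum_coordStack]
  refine Finset.sum_nonneg fun k _ => ?_
  rw [coordStack_blockOp]
  have := hW.dotProduct_mulVec_nonneg (coordStack Y k).ofLp
  simpa [PiLp.inner_apply, dotProduct, mul_comm] using this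

theorem norm_blockOp_le (W : Matrix (Fin n) (Fin n) ℝ) (Y : Stack n d) :
    ‖blockOp W Y‖ ≤ ‖Matrix.toEuclideanCLM (𝕜 := ℝ) W‖ * ‖Y‖ := by
  refine (sq_le_sq₀ (norm_nonneg _) (by positivity)).mp ?_
  rw [mul_pow, ← real_inner_self_eq_norm_sq, ← real_inner_self_eq_norm_sq Y,
    inner_eq_sum_coordStack, inner_eq_sum_coordStack, Finset.mul_sum]
  refine Finset.sum_le_sum fun k _ => ?_
  rw [real_inner_self_eq_norm_sq, real_inner_self_eq_norm_sq, coordStack_blockOp, ← mul_pow]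
  exact pow_le_pow_left₀ (norm_nonneg _) (ContinuousLinearMap.le_opNorm _ _) 2

end BlockOp

/-! ### The Laplacian, the consensus projection and the pseudoinverse. -/

section Graph

variable {n d : ℕ}

theorem consensusMatrix_transpose : (consensusMatrix n).transpose = consensusMatrix n := by
  ext i j
  simp [consensusMatrix, Matrix.one_apply, eq_comm]

theorem blockOp_consensusMatrix (X : Fin n → Vec d) :
    blockOp (consensusMatrix n) (WithLp.toLp 2 X) = WithLp.toLp 2 fun i => X i - netAvg X := by
  ext i k
  simp [blockOp_apply, consensusMatrix, netAvg, sub_mul, Matrix.one_apply, Finset.mul_sum]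

theorem consensusMatrix_mul_self (hn : n ≠ 0) :
    consensusMatrix n * consensusMatrix n = consensusMatrix n := by
  have h : (n : ℝ) ≠ 0 := by exact_mod_cast hn
  have : (Matrix.of fun _ _ => (n : ℝ)⁻¹ : Matrix (Fin n) (Fin n) ℝ) *
      (Matrix.of fun _ _ => (n : ℝ)⁻¹) = Matrix.of fun _ _ => (n : ℝ)⁻¹ := by
    ext i j
    simp [Matrix.mul_apply, h]
  rw [consensusMatrix, sub_mul, mul_sub, mul_sub, this]
  simp

variable {G : SimpleGraph (Fin n)} (o : EdgeOrientation G)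

theorem EdgeOrientation.tail_ne_head (e : G.edgeSet) : o.tail e ≠ o.head e := by
  intro h
  have h1 : s(o.tail e, o.head e) ∈ G.edgeSet := by rw [o.edge_eq]; exact e.2
  rw [SimpleGraph.mem_edgeSet] at h1
  exact h1.ne h

theorem sum_incidence (e : G.edgeSet) : ∑ i, incidence o e i = 0 := by
  have h : ∀ i, incidence o e i
      = (if i = o.tail e then (1 : ℝ) else 0) + (if i = o.head e then -1 else 0) := by
    intro i
    rw [incidence]
    by_cases h1 : i = o.tail e
    · subst h1; simp [o.tail_ne_head e]
    · simp [h1]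
  simp only [h, Finset.sum_add_distrib, Finset.sum_ite_eq', Finset.mem_univ, if_true]
  norm_num

variable [Fintype G.edgeSet]

theorem laplacian_transpose : (laplacian o).transpose = laplacian o := by
  simp [laplacian, Matrix.transpose_mul]

theorem laplacian_posSemidef : (laplacian o).PosSemidef := by
  have := Matrix.posSemidef_conjTranspose_mul_self (incidence o)
  rwa [Matrix.conjTranspose_eq_transpose_of_trivial] at this

theorem laplacian_mul_consensusMatrix : laplacian o * consensusMatrix n = laplacian o := by
  have : incidence o * (Matrix.of fun _ _ => (n : ℝ)⁻¹ : Matrix (Fin n) (Fin n) ℝ) = 0 := by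
    ext e j
    simp [Matrix.mul_apply, ← Finset.sum_mul, sum_incidence]
  rw [consensusMatrix, mul_sub, mul_one, laplacian, Matrix.mul_assoc, this]
  simp

theorem consensusMatrix_mul_laplacian : consensusMatrix n * laplacian o = laplacian o := by
  have := congrArg Matrix.transpose (laplacian_mul_consensusMatrix o)
  rwa [Matrix.transpose_mul, laplacian_transpose, consensusMatrix_transpose] at this

/-- The diagonal entry is the degree, and a connected graph on at least two vertices has no isolated
vertex. This normalises both `M` and `ρ₁` to be at least `1`. -/
theorem one_le_laplacian_diag (hn : 2 ≤ n) (hG : G.Connected) (i : Fin n) :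
    1 ≤ laplacian o i i := by
  have : Nontrivial (Fin n) := Fin.nontrivial_iff_two_le.mpr hn
  obtain ⟨j, hj⟩ := hG.preconnected.exists_adj_of_nontrivial i
  let e : G.edgeSet := ⟨s(i, j), hj⟩
  have h1 : incidence o e i * incidence o e i = 1 := by
    have h2 : s(o.tail e, o.head e) = s(i, j) := o.edge_eq e
    rw [Sym2.eq_iff] at h2
    rw [incidence]
    rcases h2 with h2 | h2
    · simp [h2.1]
    · simp [h2.2, h2.1, hj.ne]
  rw [laplacian, Matrix.mul_apply]
  simp only [Matrix.transpose_apply]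
  rw [← h1]
  exact Finset.single_le_sum (f := fun e => incidence o e i * incidence o e i)
    (fun e _ => mul_self_nonneg _) (Finset.mem_univ e)

theorem one_le_laplacianNorm (hn : 2 ≤ n) (hG : G.Connected) : 1 ≤ laplacianNorm o := by
  let i : Fin n := ⟨0, by omega⟩
  let b : EuclideanSpace ℝ (Fin n) := EuclideanSpace.single i 1
  have hb : ‖b‖ = 1 := by simp [b]
  calc 1 ≤ laplacian o i i := one_le_laplacian_diag o hn hG i
    _ = inner ℝ b (Matrix.toEuclideanCLM (𝕜 := ℝ) (laplacian o) b) := by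
      simp [b, EuclideanSpace.inner_single_left]
    _ ≤ ‖b‖ * ‖Matrix.toEuclideanCLM (𝕜 := ℝ) (laplacian o) b‖ := real_inner_le_norm _ _
    _ ≤ ‖b‖ * (laplacianNorm o * ‖b‖) :=
      mul_le_mul_of_nonneg_left (ContinuousLinearMap.le_opNorm _ _) (norm_nonneg _)
    _ = laplacianNorm o := by rw [hb]; ring

theorem one_le_of_laplacian_le (hn : 2 ≤ n) (hG : G.Connected) {ρ₁ : ℝ} (hρ₁ : 0 ≤ ρ₁)
    (hupp : (ρ₁ • consensusMatrix n - laplacian o).PosSemidef) : 1 ≤ ρ₁ := by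
  let i : Fin n := ⟨0, by omega⟩
  have h1 := hupp.diag_nonneg (i := i)
  have h2 := one_le_laplacian_diag o hn hG i
  have h3 : ρ₁ * (1 - (n : ℝ)⁻¹) ≤ ρ₁ :=
    mul_le_of_le_one_right hρ₁ (by linarith [inv_nonneg.mpr (Nat.cast_nonneg (α := ℝ) n)])
  simp [consensusMatrix] at h1
  linarith

theorem le_inner_laplacian (hn : n ≠ 0) {ρ₂ : ℝ}
    (hlow : (laplacian o - ρ₂ • consensusMatrix n).PosSemidef) (Y : Stack n d) :
    ρ₂ * ‖blockOp (consensusMatrix n) Y‖ ^ 2 ≤ inner ℝ Y (blockOp (laplacian o) Y) := by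
  have h := inner_blockOp_nonneg hlow Y
  rw [blockOp_sub, blockOp_smul, inner_sub_right, inner_smul_right] at h
  have h2 : inner ℝ Y (blockOp (consensusMatrix n) Y) = ‖blockOp (consensusMatrix n) Y‖ ^ 2 := by
    rw [← real_inner_self_eq_norm_sq, blockOp_inner_left consensusMatrix_transpose,
      ← blockOp_mul, consensusMatrix_mul_self hn]
  rw [h2] at h
  linarith

theorem IsMoorePenrose.transpose {B Q : Matrix (Fin n) (Fin n) ℝ} (h : IsMoorePenrose B Q) :
    IsMoorePenrose B.transpose Q.transpose where
  mul_mul_self := by rw [← Matrix.transpose_mul, ← Matrix.transpose_mul, ← mul_assoc,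
    h.mul_mul_self]
  self_mul_mul := by rw [← Matrix.transpose_mul, ← Matrix.transpose_mul, ← mul_assoc,
    h.self_mul_mul]
  symm_left := by rw [← Matrix.transpose_mul, h.symm_right, h.symm_right]
  symm_right := by rw [← Matrix.transpose_mul, h.symm_left, h.symm_left]

theorem pinv_laplacian_transpose :
    (pinv (laplacian o)).transpose = pinv (laplacian o) := by
  have h := (isMoorePenrose_pinv_laplacian o).transpose
  rw [laplacian_transpose] at h
  exact h.unique (isMoorePenrose_pinv_laplacian o)

theorem consensusMatrix_mul_eq_zero (hn : n ≠ 0) {ρ₂ : ℝ} (hρ₂ : 0 < ρ₂)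
    (hlow : (laplacian o - ρ₂ • consensusMatrix n).PosSemidef) {Y : Stack n d}
    (hY : blockOp (laplacian o) Y = 0) : blockOp (consensusMatrix n) Y = 0 := by
  have h := le_inner_laplacian o hn hlow Y
  rw [hY, inner_zero_right] at h
  have h2 : ‖blockOp (consensusMatrix n) Y‖ ^ 2 ≤ 0 := by
    by_contra h3
    have := mul_pos hρ₂ (not_le.mp h3)
    linarith
  simpa using h2.antisymm (sq_nonneg _)

variable {ρ₂ : ℝ}

/-- `RBY - Y` lies in the kernel of `B`, which `K` annihilates by the spectral gap; and `K` fixes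
the range of `RB`. -/
theorem pinv_mul_laplacian_apply (hn : n ≠ 0) (hρ₂ : 0 < ρ₂)
    (hlow : (laplacian o - ρ₂ • consensusMatrix n).PosSemidef) (Y : Stack n d) :
    blockOp (pinv (laplacian o)) (blockOp (laplacian o) Y) = blockOp (consensusMatrix n) Y := by
  have hMP := isMoorePenrose_pinv_laplacian o
  have h1 : blockOp (laplacian o) (blockOp (pinv (laplacian o)) (blockOp (laplacian o) Y) - Y)
      = 0 := by
    rw [map_sub, ← blockOp_mul, ← blockOp_mul, hMP.mul_mul_self, sub_self]
  have h2 := consensusMatrix_mul_eq_zero o hn hρ₂ hlow h1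
  rw [map_sub, sub_eq_zero] at h2
  rw [← h2, ← blockOp_mul, ← blockOp_mul]
  have h3 : consensusMatrix n * (pinv (laplacian o) * laplacian o)
      = pinv (laplacian o) * laplacian o := by
    have h4 : pinv (laplacian o) * laplacian o * consensusMatrix n
        = pinv (laplacian o) * laplacian o := by
      rw [mul_assoc, laplacian_mul_consensusMatrix]
    have := congrArg Matrix.transpose h4
    rwa [Matrix.transpose_mul, hMP.symm_right, consensusMatrix_transpose] at this
  rw [h3]

theorem pinv_laplacian_apply_consensusMatrix (Y : Stack n d) :
    blockOp (pinv (laplacian o)) (blockOp (consensusMatrix n) Y)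
      = blockOp (pinv (laplacian o)) Y := by
  have hMP := isMoorePenrose_pinv_laplacian o
  have h1 : laplacian o * pinv (laplacian o) * consensusMatrix n
      = laplacian o * pinv (laplacian o) := by
    have h4 : consensusMatrix n * (laplacian o * pinv (laplacian o))
        = laplacian o * pinv (laplacian o) := by
      rw [← mul_assoc, consensusMatrix_mul_laplacian]
    have := congrArg Matrix.transpose h4
    rwa [Matrix.transpose_mul, hMP.symm_left, consensusMatrix_transpose] at this
  have h2 : pinv (laplacian o) * consensusMatrix n = pinv (laplacian o) := by
    calc pinv (laplacian o) * consensusMatrix n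
        = pinv (laplacian o) * laplacian o * pinv (laplacian o) * consensusMatrix n := by
          rw [hMP.self_mul_mul]
      _ = pinv (laplacian o) * (laplacian o * pinv (laplacian o) * consensusMatrix n) := by
          simp only [mul_assoc]
      _ = pinv (laplacian o) := by rw [h1, ← mul_assoc, hMP.self_mul_mul]
  rw [← blockOp_mul, h2]

theorem consensusMatrix_apply_pinv_laplacian (Y : Stack n d) :
    blockOp (consensusMatrix n) (blockOp (pinv (laplacian o)) Y)
      = blockOp (pinv (laplacian o)) Y := by
  refine ext_inner_right ℝ fun Z => ?_
  rw [blockOp_inner_left consensusMatrix_transpose, blockOp_inner_left (pinv_laplacian_transpose o),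
    pinv_laplacian_apply_consensusMatrix, blockOp_inner_left (pinv_laplacian_transpose o)]

/-- With `Z = RY`, the identity `RBR = R` gives `ρ₂‖Z‖² ≤ ⟨Z, BZ⟩ = ⟨Z, Y⟩`. -/
theorem norm_pinv_laplacian_le (hn : n ≠ 0)
    (hlow : (laplacian o - ρ₂ • consensusMatrix n).PosSemidef) (Y : Stack n d) :
    ρ₂ * ‖blockOp (pinv (laplacian o)) Y‖ ≤ ‖Y‖ := by
  set Z := blockOp (pinv (laplacian o)) Y with hZ
  have hK : blockOp (consensusMatrix n) Z = Z := consensusMatrix_apply_pinv_laplacian o Y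
  have h := le_inner_laplacian o hn hlow Z
  have h1 : inner ℝ Z (blockOp (laplacian o) Z) = inner ℝ Z Y := by
    rw [hZ, blockOp_inner_left (pinv_laplacian_transpose o), ← blockOp_mul, ← blockOp_mul,
      (isMoorePenrose_pinv_laplacian o).self_mul_mul, real_inner_comm]
  rw [hK, h1] at h
  have h2 := h.trans (real_inner_le_norm Z Y)
  rcases eq_or_lt_of_le (norm_nonneg Z) with h3 | h3
  · rw [← h3]; simp
  · have : ‖Z‖ * (ρ₂ * ‖Z‖) ≤ ‖Z‖ * ‖Y‖ := by linarith
    exact le_of_mul_le_mul_left this h3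

end Graph

/-! ### The consensus energy along the algorithm. -/

section Consensus

variable {n d : ℕ}

theorem inner_consensusMatrix (hn : n ≠ 0) (X Y : Stack n d) :
    inner ℝ X (blockOp (consensusMatrix n) Y)
      = inner ℝ (blockOp (consensusMatrix n) X) (blockOp (consensusMatrix n) Y) := by
  rw [blockOp_inner_left consensusMatrix_transpose, ← blockOp_mul, consensusMatrix_mul_self hn]

theorem norm_sq_eq_consensus_add_avg (hn : n ≠ 0) (Y : Stack n d) :
    ‖Y‖ ^ 2 = ‖blockOp (consensusMatrix n) Y‖ ^ 2 + n * ‖netAvg Y.ofLp‖ ^ 2 := by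
  have h1 : ‖Y - blockOp (consensusMatrix n) Y‖ ^ 2 = n * ‖netAvg Y.ofLp‖ ^ 2 := by
    have h2 := blockOp_consensusMatrix Y.ofLp
    rw [WithLp.toLp_ofLp] at h2
    rw [PiLp.norm_sq_eq_of_L2, h2]
    simp
  rw [← h1, norm_sub_sq_real, inner_consensusMatrix hn, real_inner_self_eq_norm_sq]
  ring

theorem norm_consensusMatrix_le (hn : n ≠ 0) (Y : Stack n d) :
    ‖blockOp (consensusMatrix n) Y‖ ≤ ‖Y‖ := by
  refine (sq_le_sq₀ (norm_nonneg _) (norm_nonneg _)).mp ?_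
  rw [norm_sq_eq_consensus_add_avg hn Y]
  exact le_add_of_nonneg_right (by positivity)

theorem avg_norm_sq_le (hn : n ≠ 0) (Y : Stack n d) : n * ‖netAvg Y.ofLp‖ ^ 2 ≤ ‖Y‖ ^ 2 := by
  rw [norm_sq_eq_consensus_add_avg hn Y]
  exact le_add_of_nonneg_left (by positivity)

variable {G : SimpleGraph (Fin n)} [Fintype G.edgeSet] (o : EdgeOrientation G)

/-- The part of the Lyapunov function that measures the consensus and dual errors. -/
def consensusEnergy (c δ₁ α η : ℝ) (X V : Stack n d) : ℝ :=
  1 / (η * α) * inner ℝ (blockOp (consensusMatrix n) V)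
      (blockOp (pinv (laplacian o)) (blockOp (consensusMatrix n) V))
    + c / η * ‖blockOp (consensusMatrix n) V‖ ^ 2
    + ‖blockOp (consensusMatrix n) X‖ ^ 2
    + δ₁ * inner ℝ (blockOp (consensusMatrix n) X) (blockOp (consensusMatrix n) V)

/-- Since `KB = BK = B`, projecting the updates by `K` gives exactly the recursion of
`consensus_descent` for `KX`, `KV`, `Ke`, `Ku`, `Kw`. -/
theorem consensusEnergy_step (hn : n ≠ 0) {L ρ₂ η θ α N δ₁ δ₂ D : ℝ}
    (S : StepSizes L ρ₂ η θ α (laplacianNorm o) N δ₁ δ₂ D)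
    (hlow : (laplacian o - ρ₂ • consensusMatrix n).PosSemidef)
    {X V e u w X' V' : Stack n d} (hu : ‖u‖ ≤ L * ‖blockOp (consensusMatrix n) X‖)
    (hX' : X' = X + (α * θ * laplacianNorm o) • e - α • u - V
      - (α * θ) • blockOp (laplacian o) (X + e))
    (hV' : V' = V + α • (η • blockOp (laplacian o) (X + e) + w)) :
    consensusEnergy o (δ₁ / 2 * (θ + η) - θ - δ₂ * θ) δ₁ α η X' V'
      - consensusEnergy o (δ₁ / 2 * (θ + η) - θ - δ₂ * θ) δ₁ α η X V
      + δ₁ / 12 * ‖blockOp (consensusMatrix n) (X' - X)‖ ^ 2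
    ≤ -(1 / 2) * (α * (θ * ρ₂) * ‖blockOp (consensusMatrix n) X‖ ^ 2) + 5 / 8 * (D * ‖e‖ ^ 2)
      + gradientWeight ρ₂ η θ α δ₁ * ‖w‖ ^ 2 := by
  set M := laplacianNorm o with hM
  let B : Stack n d →ₗ[ℝ] Stack n d := blockOp (laplacian o)
  let R : Stack n d →ₗ[ℝ] Stack n d := blockOp (pinv (laplacian o))
  let K : Stack n d →ₗ[ℝ] Stack n d := blockOp (consensusMatrix n)
  have hBK : ∀ Y, B (K Y) = B Y := fun Y => by
    rw [← blockOp_mul, laplacian_mul_consensusMatrix]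
  have hKB : ∀ Y, K (B Y) = B Y := fun Y => by
    rw [← blockOp_mul, consensusMatrix_mul_laplacian]
  have hKK : ∀ Y, K (K Y) = K Y := fun Y => by rw [← blockOp_mul, consensusMatrix_mul_self hn]
  have hRB : ∀ Y, R (B (K Y)) = K Y := fun Y => by
    rw [pinv_mul_laplacian_apply o hn S.ρ₂_pos hlow, hKK]
  have hBnorm : ∀ Y, ‖B Y‖ ≤ M * ‖Y‖ := norm_blockOp_le (laplacian o)
  have key := consensus_descent B R
    (blockOp_inner_left (pinv_laplacian_transpose o))
    (inner_blockOp_nonneg (laplacian_posSemidef o))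
    (K X) (K V) (K e) (K u) (K w)
    ((α * θ) • (M • K e - B (K e)) - α • K u)
    ((α * θ) • (M • K e - B (K e)) - α • K u - (α * θ) • B (K X))
    (η • B (K X + K e) + K w) (hRB X) (hRB e) S hBnorm
    (norm_pinv_laplacian_le o hn hlow)
    (fun Y => by
      have h1 := norm_sub_le (M • Y) (B Y)
      rw [norm_smul, Real.norm_of_nonneg S.M_pos.le] at h1
      linarith [hBnorm Y])
    (by
      have := le_inner_laplacian o hn hlow (K X)
      change ρ₂ * ‖K (K X)‖ ^ 2 ≤ _ at this
      rwa [hKK] at this)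
    ((norm_consensusMatrix_le hn u).trans hu) rfl rfl rfl rfl
  have e1 : K X' = K X + ((α * θ) • (M • K e - B (K e)) - α • K u - (α * θ) • B (K X) - K V) := by
    rw [hX']
    change K (X + (α * θ * M) • e - α • u - V - (α * θ) • B (X + e)) = _
    simp only [map_add, map_sub, map_smul, hKB, hBK, smul_sub, smul_add, smul_smul]
    abel
  have e2 : K V' = K V + α • (η • B (K X + K e) + K w) := by
    rw [hV']
    change K (V + α • (η • B (X + e) + w)) = _
    simp only [map_add, map_smul, hKB, hBK]
  have e3 : K (X' - X) = (α * θ) • (M • K e - B (K e)) - α • K u - (α * θ) • B (K X) - K V := by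
    rw [map_sub, e1, add_sub_cancel_left]
  rw [← e1, ← e2, ← e3] at key
  have h1 : D * ‖K e‖ ^ 2 ≤ D * ‖e‖ ^ 2 :=
    mul_le_mul_of_nonneg_left (pow_le_pow_left₀ (norm_nonneg _) (norm_consensusMatrix_le hn e) 2)
      S.D_pos.le
  have hκ : 0 ≤ gradientWeight ρ₂ η θ α δ₁ := by
    have := S.ρ₂_pos; have := S.η_pos; have := S.θ_pos; have := S.α_pos; have := S.δ₁_pos
    rw [gradientWeight]; positivity
  have h2 : gradientWeight ρ₂ η θ α δ₁ * ‖K w‖ ^ 2 ≤ gradientWeight ρ₂ η θ α δ₁ * ‖w‖ ^ 2 :=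
    mul_le_mul_of_nonneg_left (pow_le_pow_left₀ (norm_nonneg _) (norm_consensusMatrix_le hn w) 2)
      hκ
  rw [consensusEnergy, consensusEnergy]
  change 1 / (η * α) * inner ℝ (K V') (R (K V')) + _ * ‖K V'‖ ^ 2 + ‖K X'‖ ^ 2
    + δ₁ * inner ℝ (K X') (K V') - (1 / (η * α) * inner ℝ (K V) (R (K V))
    + _ * ‖K V‖ ^ 2 + ‖K X‖ ^ 2 + δ₁ * inner ℝ (K X) (K V)) + δ₁ / 12 * ‖K (X' - X)‖ ^ 2
    ≤ -(1 / 2) * (α * (θ * ρ₂) * ‖K X‖ ^ 2) + _ + _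
  linarith

/-- `θ ≥ 2δ₁η` forces `c/η ≥ δ₁²/4`, so the last three terms dominate `(‖KX‖ - δ₁/2 ‖KV‖)²`; the
pseudoinverse is positive semidefinite because `R = RBR`. -/
theorem consensusEnergy_nonneg {L ρ₂ η θ α M N δ₁ δ₂ D : ℝ}
    (S : StepSizes L ρ₂ η θ α M N δ₁ δ₂ D)
    (X V : Stack n d) :
    0 ≤ consensusEnergy o (δ₁ / 2 * (θ + η) - θ - δ₂ * θ) δ₁ α η X V := by
  have hη := S.η_pos
  have hα := S.α_pos
  have hδ₁ := S.δ₁_pos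
  have hθ := S.θ_pos
  rw [consensusEnergy]
  set x := blockOp (consensusMatrix n) X
  set v := blockOp (consensusMatrix n) V with hv
  have h1 : 0 ≤ inner ℝ v (blockOp (pinv (laplacian o)) v) := by
    have h := inner_blockOp_nonneg (laplacian_posSemidef o) (blockOp (pinv (laplacian o)) v)
    rwa [blockOp_inner_left (pinv_laplacian_transpose o), ← blockOp_mul, ← blockOp_mul,
      (isMoorePenrose_pinv_laplacian o).self_mul_mul] at h
  have h2 : δ₁ ^ 2 / 4 ≤ (δ₁ / 2 * (θ + η) - θ - δ₂ * θ) / η := by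
    rw [le_div_iff₀ hη]
    have k1 := mul_le_mul_of_nonneg_right S.δ₂_le hθ.le
    have k2 := mul_le_mul_of_nonneg_right S.δ₁_ge hθ.le
    have k3 := mul_le_mul_of_nonneg_left S.δ₁_mul_η_le hδ₁.le
    have k4 : 0 ≤ δ₁ * η := by positivity
    have k5 : 0 ≤ δ₁ * θ := by positivity
    linarith
  have h3 := mul_le_mul_of_nonneg_right h2 (sq_nonneg ‖v‖)
  have h4 := mul_inner_le (c := -δ₁) (k := δ₁) (by rw [abs_neg, abs_of_nonneg hδ₁.le]) x v
  have h5 : 0 ≤ 1 / (η * α) * inner ℝ v (blockOp (pinv (laplacian o)) v) := by positivity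
  linarith [sq_nonneg (‖x‖ - δ₁ / 2 * ‖v‖)]

end Consensus

/-! ### The descent lemma and the averaged objective. -/

section Smooth

variable {E : Type*} [NormedAddCommGroup E] [InnerProductSpace ℝ E] [CompleteSpace E]

/-- The descent lemma for functions with Lipschitz gradient. -/
theorem le_add_inner_gradient_add {f : E → ℝ} {L : ℝ} (hf : Differentiable ℝ f)
    (hL : ∀ x y, ‖gradient f x - gradient f y‖ ≤ L * ‖x - y‖) (x p : E) :
    f (x + p) ≤ f x + inner ℝ (gradient f x) p + L / 2 * ‖p‖ ^ 2 := by
  let φ : ℝ → ℝ := fun t => f (x + t • p) - t * inner ℝ (gradient f x) p - L / 2 * t ^ 2 * ‖p‖ ^ 2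
  have hline : ∀ t : ℝ, HasDerivAt (fun t : ℝ => x + t • p) p t := fun t => by
    simpa using ((hasDerivAt_id t).smul_const p).const_add x
  have hφ : ∀ t, HasDerivAt φ (inner ℝ (gradient f (x + t • p)) p - inner ℝ (gradient f x) p
      - L * t * ‖p‖ ^ 2) t := by
    intro t
    have h1 : HasDerivAt (fun t : ℝ => f (x + t • p)) (inner ℝ (gradient f (x + t • p)) p) t := by
      have h := (hf (x + t • p)).hasGradientAt.hasFDerivAt.comp_hasDerivAt t (hline t)
      exact h
    have h2 : HasDerivAt (fun t : ℝ => t * inner ℝ (gradient f x) p) (inner ℝ (gradient f x) p) t := by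
      simpa using (hasDerivAt_id t).mul_const (inner ℝ (gradient f x) p)
    have h3 : HasDerivAt (fun t : ℝ => L / 2 * t ^ 2 * ‖p‖ ^ 2) (L * t * ‖p‖ ^ 2) t := by
      have := (((hasDerivAt_pow 2 t).const_mul (L / 2)).mul_const (‖p‖ ^ 2))
      refine this.congr_deriv ?_
      simp only [Nat.cast_ofNat, Nat.add_one_sub_one, pow_one]
      ring
    exact (h1.sub h2).sub h3
  have hanti : AntitoneOn φ (Set.Icc 0 1) := by
    refine antitoneOn_of_deriv_nonpos (convex_Icc 0 1)
      (fun t _ => (hφ t).continuousAt.continuousWithinAt)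
      (fun t _ => (hφ t).differentiableAt.differentiableWithinAt) ?_
    intro t ht
    rw [interior_Icc] at ht
    rw [(hφ t).deriv, ← inner_sub_left]
    have h1 := real_inner_le_norm (gradient f (x + t • p) - gradient f x) p
    have h2 := hL (x + t • p) x
    rw [add_sub_cancel_left, norm_smul, Real.norm_of_nonneg ht.1.le] at h2
    have h3 := mul_le_mul_of_nonneg_right h2 (norm_nonneg p)
    linarith
  have := hanti (Set.left_mem_Icc.mpr zero_le_one) (Set.right_mem_Icc.mpr zero_le_one) zero_le_one
  simp only [φ, one_smul, zero_smul, add_zero] at this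
  linarith

end Smooth

section Objective

variable {n d : ℕ} {f : Fin n → Vec d → ℝ}

theorem differentiable_avgObj (hf : ∀ i, Differentiable ℝ (f i)) :
    Differentiable ℝ (avgObj f) :=
  (Differentiable.fun_sum fun i _ => hf i).const_mul _

theorem gradient_avgObj (hf : ∀ i, Differentiable ℝ (f i)) (x : Vec d) :
    gradient (avgObj f) x = avgGrad f x := by
  have h : HasFDerivAt (avgObj f) ((n : ℝ)⁻¹ • ∑ i, fderiv ℝ (f i) x) x :=
    (HasFDerivAt.fun_sum fun i _ => (hf i x).hasFDerivAt).const_mul _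
  rw [gradient, h.fderiv, avgGrad]
  simp [gradient, map_sum]

theorem norm_avgGrad_sub_le (hn : n ≠ 0) {L : ℝ}
    (hL : ∀ i x y, ‖gradient (f i) x - gradient (f i) y‖ ≤ L * ‖x - y‖) (x y : Vec d) :
    ‖avgGrad f x - avgGrad f y‖ ≤ L * ‖x - y‖ := by
  have hn' : (0 : ℝ) < n := by exact_mod_cast Nat.pos_of_ne_zero hn
  rw [avgGrad, avgGrad, ← smul_sub, ← Finset.sum_sub_distrib, norm_smul, norm_inv,
    Real.norm_of_nonneg hn'.le, inv_mul_le_iff₀ hn']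
  refine (norm_sum_le _ _).trans ((Finset.sum_le_sum fun i _ => hL i x y).trans (le_of_eq ?_))
  simp

theorem avgObj_add_le (hn : n ≠ 0) (hf : ∀ i, Differentiable ℝ (f i)) {L : ℝ}
    (hL : ∀ i x y, ‖gradient (f i) x - gradient (f i) y‖ ≤ L * ‖x - y‖) (x p : Vec d) :
    avgObj f (x + p) ≤ avgObj f x + inner ℝ (avgGrad f x) p + L / 2 * ‖p‖ ^ 2 := by
  have := le_add_inner_gradient_add (differentiable_avgObj hf)
    (fun x y => by
      rw [gradient_avgObj hf, gradient_avgObj hf]; exact norm_avgGrad_sub_le hn hL x y) x p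
  rwa [gradient_avgObj hf] at this

end Objective

/-! ### Pathwise descent of the Lyapunov function. -/

section Network

variable {n d : ℕ}

theorem netAvg_add (X Y : Fin n → Vec d) : netAvg (X + Y) = netAvg X + netAvg Y := by
  simp [netAvg, Finset.sum_add_distrib]

theorem netAvg_sub (X Y : Fin n → Vec d) : netAvg (X - Y) = netAvg X - netAvg Y := by
  simp [netAvg, Finset.sum_sub_distrib, smul_sub]

theorem netAvg_smul (c : ℝ) (X : Fin n → Vec d) : netAvg (c • X) = c • netAvg X := by
  simp [netAvg, ← Finset.smul_sum, smul_comm c]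

variable {G : SimpleGraph (Fin n)} [Fintype G.edgeSet] (o : EdgeOrientation G)

theorem sum_blockMul_incidence_transpose (l : G.edgeSet → Vec d) :
    ∑ i, blockMul (incidence o).transpose l i = 0 := by
  simp only [blockMul, Matrix.transpose_apply]
  rw [Finset.sum_comm]
  simp [← Finset.sum_smul, sum_incidence]

theorem sum_blockMul_laplacian (X : Fin n → Vec d) :
    ∑ i, blockMul (laplacian o) X i = 0 := by
  have : blockMul (laplacian o) X
      = blockMul (incidence o).transpose (fun e => ∑ j, incidence o e j • X j) := by
    ext1 i
    simp only [blockMul, laplacian, Matrix.mul_apply, Finset.sum_smul, Finset.smul_sum, smul_smul]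
    rw [Finset.sum_comm]
  rw [this, sum_blockMul_incidence_transpose]

theorem netAvg_blockMul_laplacian (X : Fin n → Vec d) :
    netAvg (blockMul (laplacian o) X) = 0 := by
  rw [netAvg, sum_blockMul_laplacian, smul_zero]

/-- `K` is an orthogonal projection with `RK = KR = R`, so the weighted terms depend only on `KX`
and `KV`; the factor `α` in front of `c` cancels against `1/(ηα)`. -/
theorem lyapunov_eq (hn : n ≠ 0) (f : Fin n → Vec d → ℝ) (fstar α θ η δ ρ₂ a : ℝ) (hη : η ≠ 0)
    (hα : α ≠ 0) (s : TiCoPDState n d) :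
    lyapunov o f fstar α θ η δ ρ₂ a s = avgObj f (netAvg s.x) - fstar
      + a * consensusEnergy o (delta1 η δ ρ₂ / 2 * (θ + η) - θ - delta2 η δ * θ)
        (delta1 η δ ρ₂) α η (WithLp.toLp 2 s.x) (WithLp.toLp 2 (dualError f α s))
      + delta2 η δ * a * stackNormSq (fun i => s.xhat i - s.x i) := by
  rw [lyapunov, consensusEnergy]
  simp only [wNormSq, wInner_eq_inner, blockOp_add, blockOp_smul, inner_add_right,
    inner_smul_right]
  set X : Stack n d := WithLp.toLp 2 s.x
  set V : Stack n d := WithLp.toLp 2 (dualError f α s)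
  rw [inner_consensusMatrix hn V V, inner_consensusMatrix hn X X, inner_consensusMatrix hn X V,
    real_inner_self_eq_norm_sq, real_inner_self_eq_norm_sq, pinv_laplacian_apply_consensusMatrix,
    blockOp_inner_left consensusMatrix_transpose V (blockOp (pinv (laplacian o)) V),
    consensusMatrix_apply_pinv_laplacian]
  field_simp
  ring

theorem lyapunov_nonneg (hn : n ≠ 0) {f : Fin n → Vec d → ℝ} {fstar : ℝ}
    (hfstar : fstar ∈ lowerBounds (Set.range (avgObj f))) {L ρ₂ η θ α M N a δ D : ℝ} (ha : 0 < a)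
    (S : StepSizes L ρ₂ η θ α M N (delta1 η δ ρ₂) (delta2 η δ) D) (s : TiCoPDState n d) :
    0 ≤ lyapunov o f fstar α θ η δ ρ₂ a s := by
  rw [lyapunov_eq o hn f fstar α θ η δ ρ₂ a S.η_pos.ne' S.α_pos.ne']
  have h1 := hfstar (Set.mem_range_self (netAvg s.x))
  have h2 := mul_nonneg ha.le (consensusEnergy_nonneg o S (WithLp.toLp 2 s.x)
    (WithLp.toLp 2 (dualError f α s)))
  have h3 : 0 ≤ stackNormSq (fun i => s.xhat i - s.x i) :=
    Finset.sum_nonneg fun i _ => sq_nonneg _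
  have h4 := S.δ₂_ge
  have h5 : 0 ≤ delta2 η δ * a * stackNormSq (fun i => s.xhat i - s.x i) := by positivity
  linarith

/-- One step of the algorithm decreases the Lyapunov function, up to the part of the compression
error that is controlled only in expectation. -/
theorem lyapunov_step_le (hn : n ≠ 0) {f : Fin n → Vec d → ℝ} (hf : ∀ i, Differentiable ℝ (f i))
    {fstar L ρ₂ η θ α β αt a δ : ℝ}
    (hL : ∀ i x y, ‖gradient (f i) x - gradient (f i) y‖ ≤ L * ‖x - y‖)
    (hδ : 0 < δ) (hδ1 : δ ≤ 1) (ha : 0 < a) (hθa : 4 * L ^ 2 / (n * ρ₂ * a) ≤ θ)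
    (hαt : 0 < αt) (hα : α = 1 / (1 / αt + θ * laplacianNorm o)) (hβ : β = α / αt)
    (S : StepSizes L ρ₂ η θ α (laplacianNorm o) (n * a) (delta1 η δ ρ₂) (delta2 η δ)
      (δ * delta2 η δ))
    (hlow : (laplacian o - ρ₂ • consensusMatrix n).PosSemidef)
    (s : TiCoPDState n d) (hlam : ∑ i, s.lam i = 0) (q : Fin n → Vec d → Vec d)
    (s' : TiCoPDState n d) (hs' : s' = ticopdStep o f α β θ η q s) :
    lyapunov o f fstar α θ η δ ρ₂ a s'
        - delta2 η δ * a * stackNormSq (fun i => s'.xhat i - s'.x i)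
        + delta2 η δ * a * ((1 - δ) ^ 2 * stackNormSq (fun i => s'.x i - s.xhat i))
      ≤ lyapunov o f fstar α θ η δ ρ₂ a s - α / 16 * ‖avgGrad f (netAvg s.x)‖ ^ 2
        - α * θ * ρ₂ * a / 4 * wNormSq (consensusMatrix n) s.x := by
  have hn' : (0 : ℝ) < n := by exact_mod_cast Nat.pos_of_ne_zero hn
  have hL0 := S.L_nonneg
  have hα0 := S.α_pos
  have hθ0 := S.θ_pos
  have hM0 := S.M_pos
  have hρ₂ := S.ρ₂_pos
  have hδ₂ := S.δ₂_ge
  have hδ₁ := S.δ₁_pos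
  have hβ' : 1 - β = α * θ * laplacianNorm o := by
    have : 0 < 1 / αt + θ * laplacianNorm o := by positivity
    rw [hβ, hα]
    field_simp
    ring
  rw [lyapunov_eq o hn f fstar α θ η δ ρ₂ a S.η_pos.ne' S.α_pos.ne',
    lyapunov_eq o hn f fstar α θ η δ ρ₂ a S.η_pos.ne' S.α_pos.ne', stackNormSq_eq_norm_sq,
    stackNormSq_eq_norm_sq, stackNormSq_eq_norm_sq]
  set M := laplacianNorm o
  set δ₁ := delta1 η δ ρ₂
  set δ₂ := delta2 η δ
  let X : Stack n d := WithLp.toLp 2 s.x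
  let X' : Stack n d := WithLp.toLp 2 s'.x
  let V : Stack n d := WithLp.toLp 2 (dualError f α s)
  let V' : Stack n d := WithLp.toLp 2 (dualError f α s')
  let e : Stack n d := WithLp.toLp 2 fun i => s.xhat i - s.x i
  let u : Stack n d := WithLp.toLp 2 fun i => gradient (f i) (s.x i) - gradient (f i) (netAvg s.x)
  let w : Stack n d := WithLp.toLp 2 fun i =>
    gradient (f i) (netAvg s'.x) - gradient (f i) (netAvg s.x)
  set p := netAvg s'.x - netAvg s.x with hp
  set g := netAvg fun i => gradient (f i) (s.x i) with hg
  set eb := netAvg fun i => s.xhat i - s.x i with heb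
  have hXe : X + e = WithLp.toLp 2 s.xhat := by
    ext i k; simp [X, e]
  have hX' : X' = X + (α * θ * M) • e - α • u - V - (α * θ) • blockOp (laplacian o) (X + e) := by
    rw [hXe, blockOp_toLp]
    ext i k
    simp [X', X, e, u, V, hs', ticopdStep, dualError, ← hβ']
    ring
  have hV' : V' = V + α • (η • blockOp (laplacian o) (X + e) + w) := by
    rw [hXe, blockOp_toLp]
    ext i k
    simp [V, V', w, dualError]
    simp [hs', ticopdStep]
    ring
  have hu : ‖u‖ ≤ L * ‖blockOp (consensusMatrix n) X‖ := by
    refine (sq_le_sq₀ (norm_nonneg _) (by positivity)).mp ?_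
    rw [mul_pow, blockOp_consensusMatrix, PiLp.norm_sq_eq_of_L2, PiLp.norm_sq_eq_of_L2,
      Finset.mul_sum]
    refine Finset.sum_le_sum fun i _ => ?_
    rw [← mul_pow]
    exact pow_le_pow_left₀ (norm_nonneg _) (hL i _ _) 2
  have hw : ‖w‖ ^ 2 ≤ n * (L ^ 2 * ‖p‖ ^ 2) := by
    rw [PiLp.norm_sq_eq_of_L2]
    refine (Finset.sum_le_sum (g := fun _ => L ^ 2 * ‖p‖ ^ 2) fun i _ => ?_).trans
      (le_of_eq (by simp))
    rw [← mul_pow]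
    exact pow_le_pow_left₀ (norm_nonneg _) (hL i _ _) 2
  -- Averaging removes `λ̃` and the Laplacian term; the compression error survives only through the
  -- weight `1 - β`.
  have hp' : p = -(α • (g - (θ * M) • eb)) := by
    have h1 : s'.x = s.x + (1 - β) • (fun i => s.xhat i - s.x i)
        - α • ((fun i => gradient (f i) (s.x i)) + s.lam + θ • blockMul (laplacian o) s.xhat) := by
      ext i k
      simp [hs', ticopdStep]
      ring
    have h2 : netAvg s.lam = 0 := by rw [netAvg, hlam, smul_zero]
    rw [hp, h1, netAvg_sub, netAvg_add, netAvg_smul, netAvg_smul, netAvg_add, netAvg_add,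
      netAvg_smul, netAvg_blockMul_laplacian, h2, ← hg, ← heb, hβ']
    module
  have key := consensusEnergy_step o hn S hlow hu hX' hV'
  have hdesc := avgObj_add_le hn hf hL (netAvg s.x) p
  have hxp : netAvg s.x + p = netAvg s'.x := by rw [hp]; abel
  rw [hxp] at hdesc
  have hcomp : (1 - δ) ^ 2 * ‖(WithLp.toLp 2 fun i => s'.x i - s.xhat i : Stack n d)‖ ^ 2
      ≤ (1 - 3 / 4 * δ) * ‖e‖ ^ 2 + deltaTilde δ * ‖X' - X‖ ^ 2 := by
    refine compression_young hδ hδ1 (pow_le_pow_left₀ (norm_nonneg _) ?_ 2)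
    have : (WithLp.toLp 2 fun i => s'.x i - s.xhat i : Stack n d) = (X' - X) - e := by
      ext i k; simp [X', X, e]
    rw [this, add_comm]
    exact norm_sub_le _ _
  have hdiff : ‖X' - X‖ ^ 2 = ‖blockOp (consensusMatrix n) (X' - X)‖ ^ 2 + n * ‖p‖ ^ 2 := by
    rw [norm_sq_eq_consensus_add_avg hn]
    have : netAvg (X' - X).ofLp = p := netAvg_sub s'.x s.x
    rw [this]
  have heb' : n * ‖eb‖ ^ 2 ≤ ‖e‖ ^ 2 := avg_norm_sq_le hn e
  have hgb : n * ‖g - avgGrad f (netAvg s.x)‖ ^ 2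
      ≤ L ^ 2 * ‖blockOp (consensusMatrix n) X‖ ^ 2 := by
    have h1 : netAvg u.ofLp = g - avgGrad f (netAvg s.x) := netAvg_sub _ _
    rw [← h1, ← mul_pow]
    exact (avg_norm_sq_le hn u).trans (pow_le_pow_left₀ (norm_nonneg _) hu 2)
  -- Polarisation of `-α⟨∇f, g⟩` retains `-α/2 ‖g‖²`, which `h4` spends.
  have hin : inner ℝ (avgGrad f (netAvg s.x)) p
      ≤ α / 2 * (‖g - avgGrad f (netAvg s.x)‖ ^ 2 - ‖avgGrad f (netAvg s.x)‖ ^ 2 - ‖g‖ ^ 2)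
        + α / 4 * ‖avgGrad f (netAvg s.x)‖ ^ 2 + α * (θ * M) ^ 2 * ‖eb‖ ^ 2 := by
    have h0 : inner ℝ (avgGrad f (netAvg s.x)) p = -(α * inner ℝ (avgGrad f (netAvg s.x)) g)
        + α * (θ * M) * inner ℝ (avgGrad f (netAvg s.x)) eb := by
      rw [hp', inner_neg_right, inner_smul_right, inner_sub_right, inner_smul_right]
      ring
    rw [h0, norm_sub_sq_real, real_inner_comm]
    have h1 := mul_le_mul_of_nonneg_left (real_inner_le_norm (avgGrad f (netAvg s.x)) eb)
      (by positivity : 0 ≤ α * (θ * M))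
    have h2 := mul_nonneg hα0.le (sq_nonneg (‖avgGrad f (netAvg s.x)‖ / 2 - θ * M * ‖eb‖))
    linarith
  have hpn : ‖p‖ ^ 2 ≤ 2 * α ^ 2 * (‖g‖ ^ 2 + (θ * M) ^ 2 * ‖eb‖ ^ 2) := by
    have h1 : ‖p‖ ≤ α * (‖g‖ + θ * M * ‖eb‖) := by
      rw [hp', norm_neg, norm_smul, Real.norm_of_nonneg hα0.le]
      refine mul_le_mul_of_nonneg_left ((norm_sub_le _ _).trans (le_of_eq ?_)) hα0.le
      rw [norm_smul, Real.norm_of_nonneg (by positivity)]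
    refine (pow_le_pow_left₀ (norm_nonneg _) h1 2).trans ?_
    linarith [mul_nonneg (sq_nonneg α) (sq_nonneg (‖g‖ - θ * M * ‖eb‖))]
  have hδt : δ₂ * deltaTilde δ ≤ δ₁ / 12 := by
    have : 12 * (δ₂ * deltaTilde δ) ≤ δ₁ :=
      mul_le_mul_of_nonneg_left ((le_max_right _ _).trans (le_max_right _ _)) (by norm_num)
    linarith
  have hwn : wNormSq (consensusMatrix n) s.x = ‖blockOp (consensusMatrix n) X‖ ^ 2 := by
    rw [wNormSq, wInner_eq_inner, inner_consensusMatrix hn, real_inner_self_eq_norm_sq]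
  rw [hwn]
  have hκ : 0 ≤ gradientWeight ρ₂ η θ α δ₁ := by
    have := S.η_pos
    rw [gradientWeight]; positivity
  have hθa' : 4 * L ^ 2 ≤ θ * ρ₂ * (n * a) := by
    rw [div_le_iff₀ (by positivity)] at hθa
    linarith
  change _ + a * consensusEnergy o _ _ _ _ X' V' + _ - _ + _ ≤
    _ + a * consensusEnergy o _ _ _ _ X V + δ₂ * a * ‖e‖ ^ 2 - _ - _
  generalize consensusEnergy o _ _ _ _ X' V' = E' at *
  generalize consensusEnergy o _ _ _ _ X V = E₀ at *
  have h1 := mul_le_mul_of_nonneg_left key ha.le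
  have h2 := mul_le_mul_of_nonneg_left hcomp (by positivity : 0 ≤ δ₂ * a)
  have h3 := mul_le_mul_of_nonneg_left hw (mul_nonneg ha.le hκ)
  have h4 : (L / 2 + n * a * (gradientWeight ρ₂ η θ α δ₁ * L ^ 2 + δ₁ / 12)) * ‖p‖ ^ 2
      ≤ α / 2 * (‖g‖ ^ 2 + (θ * M) ^ 2 * ‖eb‖ ^ 2) := by
    have k1 := mul_le_mul_of_nonneg_left hpn (by positivity :
      0 ≤ L / 2 + n * a * (gradientWeight ρ₂ η θ α δ₁ * L ^ 2 + δ₁ / 12))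
    have k2 := mul_le_mul_of_nonneg_right S.gradientWeight_le
      (by positivity : 0 ≤ α * (‖g‖ ^ 2 + (θ * M) ^ 2 * ‖eb‖ ^ 2))
    linarith
  have h5 : α * (θ * M) ^ 2 * ‖eb‖ ^ 2 ≤ a * (δ * δ₂ * ‖e‖ ^ 2) / 320 := by
    have k1 := mul_le_mul_of_nonneg_right S.α_mul_M_N (sq_nonneg ‖eb‖)
    have k2 := mul_le_mul_of_nonneg_left heb' (by positivity : 0 ≤ a * (δ * δ₂))
    linarith
  have h6 : ‖g - avgGrad f (netAvg s.x)‖ ^ 2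
      ≤ θ * ρ₂ * a / 4 * ‖blockOp (consensusMatrix n) X‖ ^ 2 := by
    have k1 := mul_le_mul_of_nonneg_right hθa' (sq_nonneg ‖blockOp (consensusMatrix n) X‖)
    have k2 : n * ‖g - avgGrad f (netAvg s.x)‖ ^ 2
        ≤ n * (θ * ρ₂ * a / 4 * ‖blockOp (consensusMatrix n) X‖ ^ 2) := by linarith
    exact le_of_mul_le_mul_left k2 hn'
  have h7 := mul_le_mul_of_nonneg_left h6 hα0.le
  have h8 := mul_le_mul_of_nonneg_right hδt (by positivity : 0 ≤ a * ‖X' - X‖ ^ 2)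
  rw [hdiff] at h2 h8
  have h9 : 0 ≤ a * (δ * δ₂ * ‖e‖ ^ 2) := by positivity
  have h10 : 0 ≤ α * ‖avgGrad f (netAvg s.x)‖ ^ 2 := by positivity
  have h11 : 0 ≤ α * (θ * ρ₂ * a * ‖blockOp (consensusMatrix n) X‖ ^ 2) := by positivity
  -- Final balance. Compression: `5/8 + 3/640 < 3/4`. Consensus: `-1/2 + 1/8 ≤ -1/4`. Gradient:
  -- `-1/4 ≤ -1/16`.
  clear_value δ₁ δ₂ p g eb
  linarith

end Network

/-! ### Second moments. -/

section SquareIntegrable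

variable {Ω : Type*} [MeasurableSpace Ω] {μ : Measure Ω} {n d : ℕ}

theorem memLp_two_iff_integrable_norm_sq {E : Type*} [NormedAddCommGroup E] {X : Ω → E}
    (hX : AEStronglyMeasurable X μ) :
    MemLp X 2 μ ↔ Integrable (fun ω => ‖X ω‖ ^ 2) μ := by
  simpa using memLp_two_iff_integrable_sq_norm hX

theorem integrable_inner_of_memLp {E : Type*} [NormedAddCommGroup E] [InnerProductSpace ℝ E]
    {X Y : Ω → E} (hX : MemLp X 2 μ) (hY : MemLp Y 2 μ) :
    Integrable (fun ω => inner ℝ (X ω) (Y ω)) μ := by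
  have h1 := (memLp_two_iff_integrable_norm_sq hX.1).mp hX
  have h2 := (memLp_two_iff_integrable_norm_sq hY.1).mp hY
  refine (h1.add h2).mono' (hX.1.inner hY.1) (Filter.Eventually.of_forall fun ω => ?_)
  rw [Real.norm_eq_abs]
  refine (abs_real_inner_le_norm _ _).trans ?_
  simp only [Pi.add_apply]
  nlinarith [sq_nonneg (‖X ω‖ - ‖Y ω‖), sq_nonneg (‖X ω‖ + ‖Y ω‖)]

theorem memLp_comp_of_lipschitz [IsFiniteMeasure μ] {E F : Type*} [NormedAddCommGroup E]
    [NormedAddCommGroup F] {g : E → F} {L : ℝ} (hL : 0 ≤ L)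
    (hg : ∀ x y, ‖g x - g y‖ ≤ L * ‖x - y‖) {X : Ω → E} (hX : MemLp X 2 μ) :
    MemLp (fun ω => g (X ω)) 2 μ := by
  have hlip : LipschitzWith ⟨L, hL⟩ (fun x => g x - g 0) :=
    LipschitzWith.of_dist_le_mul fun x y => by
      rw [dist_eq_norm, dist_eq_norm, sub_sub_sub_cancel_right]
      exact hg x y
  have h1 := hlip.comp_memLp (by simp) hX
  have h2 := h1.add (memLp_const (g 0))
  have h3 : ((fun x => g x - g 0) ∘ X + fun _ => g 0) = fun ω => g (X ω) := by
    ext ω; simp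
  rwa [h3] at h2

theorem memLp_blockMul {ι κ : Type*} [Fintype κ] (B : Matrix ι κ ℝ) {X : Ω → κ → Vec d}
    (hX : ∀ j, MemLp (fun ω => X ω j) 2 μ) (i : ι) :
    MemLp (fun ω => blockMul B (X ω) i) 2 μ :=
  memLp_finsetSum _ fun j _ => (hX j).const_smul (B i j)

theorem memLp_netAvg {X : Ω → Fin n → Vec d} (hX : ∀ j, MemLp (fun ω => X ω j) 2 μ) :
    MemLp (fun ω => netAvg (X ω)) 2 μ :=
  (memLp_finsetSum _ fun j _ => hX j).const_smul ((n : ℝ)⁻¹)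

theorem integrable_wInner (W : Matrix (Fin n) (Fin n) ℝ) {X Y : Ω → Fin n → Vec d}
    (hX : ∀ j, MemLp (fun ω => X ω j) 2 μ) (hY : ∀ j, MemLp (fun ω => Y ω j) 2 μ) :
    Integrable (fun ω => wInner W (X ω) (Y ω)) μ :=
  integrable_finsetSum _ fun i _ => integrable_inner_of_memLp (hX i) (memLp_blockMul W hY i)

theorem integrable_stackNormSq {X : Ω → Fin n → Vec d}
    (hX : ∀ j, MemLp (fun ω => X ω j) 2 μ) : Integrable (fun ω => stackNormSq (X ω)) μ :=
  integrable_finsetSum _ fun i _ => (memLp_two_iff_integrable_norm_sq (hX i).1).mp (hX i)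

end SquareIntegrable

/-! ### Compression of an independent random vector. -/

section Compressor

variable {Ω S : Type*} [MeasurableSpace Ω] [MeasurableSpace S] {μ : Measure Ω}
  [IsProbabilityMeasure μ] {E : Type*} [NormedAddCommGroup E] [MeasurableSpace E] [BorelSpace E]
  [SecondCountableTopology E]

/-- A contraction bound on a random map passes to independent random arguments. -/
theorem lintegral_compress_le {q : E → S → E} (hq : Measurable fun p : E × S => q p.1 p.2)
    {Y : Ω → E} {Z : Ω → S} (hY : Measurable Y) (hZ : Measurable Z) (hind : IndepFun Y Z μ)
    {c : ℝ} (hc : ∀ x, ∫⁻ ω, ENNReal.ofReal (‖q x (Z ω) - x‖ ^ 2) ∂μ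
      ≤ ENNReal.ofReal (c * ‖x‖ ^ 2)) :
    ∫⁻ ω, ENNReal.ofReal (‖q (Y ω) (Z ω) - Y ω‖ ^ 2) ∂μ
      ≤ ∫⁻ ω, ENNReal.ofReal (c * ‖Y ω‖ ^ 2) ∂μ := by
  have hm : Measurable fun p : E × S => ENNReal.ofReal (‖q p.1 p.2 - p.1‖ ^ 2) :=
    ((hq.sub measurable_fst).norm.pow_const 2).ennreal_ofReal
  have hm2 : Measurable fun x : E => ENNReal.ofReal (c * ‖x‖ ^ 2) := by fun_prop
  calc ∫⁻ ω, ENNReal.ofReal (‖q (Y ω) (Z ω) - Y ω‖ ^ 2) ∂μ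
      = ∫⁻ p, ENNReal.ofReal (‖q p.1 p.2 - p.1‖ ^ 2) ∂(μ.map fun ω => (Y ω, Z ω)) := by
        rw [lintegral_map hm (hY.prodMk hZ)]
    -- Independence makes the joint law a product; Tonelli then freezes the argument `x`, where the
    -- assumption applies.
    _ = ∫⁻ p, ENNReal.ofReal (‖q p.1 p.2 - p.1‖ ^ 2) ∂((μ.map Y).prod (μ.map Z)) := by
        rw [(indepFun_iff_map_prod_eq_prod_map_map hY.aemeasurable hZ.aemeasurable).mp hind]
    _ = ∫⁻ x, ∫⁻ z, ENNReal.ofReal (‖q x z - x‖ ^ 2) ∂(μ.map Z) ∂(μ.map Y) := by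
        have := Measure.isProbabilityMeasure_map (μ := μ) hZ.aemeasurable
        rw [lintegral_prod _ hm.aemeasurable]
    _ ≤ ∫⁻ x, ENNReal.ofReal (c * ‖x‖ ^ 2) ∂(μ.map Y) := by
        refine lintegral_mono fun x => ?_
        exact (lintegral_map (f := fun z => ENNReal.ofReal (‖q x z - x‖ ^ 2))
          (hm.comp measurable_prodMk_left) hZ).trans_le (hc x)
    _ = ∫⁻ ω, ENNReal.ofReal (c * ‖Y ω‖ ^ 2) ∂μ := lintegral_map hm2 hY

/-- The bound is used first as a Lebesgue integral, where it proves integrability, and only then as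
an inequality between Bochner integrals. -/
theorem memLp_compress {q : E → S → E} (hq : Measurable fun p : E × S => q p.1 p.2)
    {Y : Ω → E} {Z : Ω → S} (hY : Measurable Y) (hZ : Measurable Z) (hind : IndepFun Y Z μ)
    (hY2 : MemLp Y 2 μ) {c : ℝ} (hc0 : 0 ≤ c)
    (hc : ∀ x, ∫⁻ ω, ENNReal.ofReal (‖q x (Z ω) - x‖ ^ 2) ∂μ ≤ ENNReal.ofReal (c * ‖x‖ ^ 2)) :
    MemLp (fun ω => q (Y ω) (Z ω) - Y ω) 2 μ
      ∧ ∫ ω, ‖q (Y ω) (Z ω) - Y ω‖ ^ 2 ∂μ ≤ c * ∫ ω, ‖Y ω‖ ^ 2 ∂μ := by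
  have h := lintegral_compress_le hq hY hZ hind hc
  have hYi : Integrable (fun ω => c * ‖Y ω‖ ^ 2) μ :=
    ((memLp_two_iff_integrable_norm_sq hY2.1).mp hY2).const_mul c
  have hD : Measurable fun ω => q (Y ω) (Z ω) - Y ω := (hq.comp (hY.prodMk hZ)).sub hY
  have hDm : Measurable fun ω => ‖q (Y ω) (Z ω) - Y ω‖ ^ 2 := hD.norm.pow_const 2
  rw [← ofReal_integral_eq_lintegral_ofReal hYi
    (Filter.Eventually.of_forall fun ω => by positivity)] at h
  have hi : Integrable (fun ω => ‖q (Y ω) (Z ω) - Y ω‖ ^ 2) μ :=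
    (lintegral_ofReal_ne_top_iff_integrable hDm.aestronglyMeasurable
      (Filter.Eventually.of_forall fun ω => by positivity)).mp (h.trans_lt ENNReal.ofReal_lt_top).ne
  refine ⟨(memLp_two_iff_integrable_norm_sq hD.aestronglyMeasurable).mpr hi, ?_⟩
  rw [← ofReal_integral_eq_lintegral_ofReal hi
    (Filter.Eventually.of_forall fun ω => by positivity), integral_const_mul] at h
  exact (ENNReal.ofReal_le_ofReal_iff
    (mul_nonneg hc0 (integral_nonneg fun ω => by positivity))).mp h

end Compressor

/-! ### The filtration of the seeds. -/

section Adapted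

variable {Ω β : Type*} [mβ : MeasurableSpace β]

/-- The information carried by the random variables `Z 0, …, Z t`. -/
abbrev pastSigma (Z : ℕ → Ω → β) (t : ℕ) : MeasurableSpace Ω :=
  ⨆ k ∈ Set.Iic t, mβ.comap (Z k)

theorem pastSigma_mono (Z : ℕ → Ω → β) {s t : ℕ} (h : s ≤ t) : pastSigma Z s ≤ pastSigma Z t :=
  biSup_mono fun _ hk => le_trans hk h

theorem measurable_pastSigma (Z : ℕ → Ω → β) (t : ℕ) : Measurable[pastSigma Z t] (Z t) :=
  Measurable.of_comap_le (le_biSup (fun k => mβ.comap (Z k)) (Set.mem_Iic.mpr le_rfl))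

variable [m0 : MeasurableSpace Ω]

theorem pastSigma_le {Z : ℕ → Ω → β} (hZ : ∀ t, Measurable (Z t)) (t : ℕ) : pastSigma Z t ≤ m0 :=
  iSup₂_le fun k _ => (hZ k).comap_le

theorem indepFun_of_measurable_pastSigma {μ : Measure Ω} {Z : ℕ → Ω → β} (hZ : ∀ t, Measurable (Z t))
    (hind : iIndepFun Z μ) {t : ℕ} {γ : Type*} [MeasurableSpace γ] {Y : Ω → γ}
    (hY : Measurable[pastSigma Z t] Y) : IndepFun Y (Z (t + 1)) μ := by
  have h := indep_iSup_of_disjoint (fun k => (hZ k).comap_le) ((iIndepFun_iff_iIndep _ _ _).mp hind)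
    (S := Set.Iic t) (T := {t + 1}) (by simp)
  rw [iSup_singleton] at h
  exact (IndepFun_iff_Indep _ _ _).mpr (indep_of_indep_of_le_left h hY.comap_le)

end Adapted

/-! ### Measurability and square integrability of the iterates. -/

section RandomState

variable {Ω : Type*} {n d : ℕ}

/-- All variables of a random state are measurable. -/
structure MeasurableState [MeasurableSpace Ω] (s : Ω → TiCoPDState n d) : Prop where
  x : ∀ i, Measurable fun ω => (s ω).x i
  xhat : ∀ i, Measurable fun ω => (s ω).xhat i
  lam : ∀ i, Measurable fun ω => (s ω).lam i

/-- All variables of a random state are square integrable. -/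
structure SquareIntegrableState [MeasurableSpace Ω] (s : Ω → TiCoPDState n d) (μ : Measure Ω) :
    Prop where
  x : ∀ i, MemLp (fun ω => (s ω).x i) 2 μ
  xhat : ∀ i, MemLp (fun ω => (s ω).xhat i) 2 μ
  lam : ∀ i, MemLp (fun ω => (s ω).lam i) 2 μ

theorem MeasurableState.mono {m₁ m₂ : MeasurableSpace Ω} (h : m₁ ≤ m₂)
    {s : Ω → TiCoPDState n d} (hs : @MeasurableState Ω n d m₁ s) : @MeasurableState Ω n d m₂ s :=
  @MeasurableState.mk _ _ _ m₂ s
    (fun i => (@MeasurableState.x _ _ _ m₁ s hs i).mono h le_rfl)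
    (fun i => (@MeasurableState.xhat _ _ _ m₁ s hs i).mono h le_rfl)
    (fun i => (@MeasurableState.lam _ _ _ m₁ s hs i).mono h le_rfl)

theorem continuous_gradient_of_lipschitz {g : Vec d → ℝ} {L : ℝ} (hL : 0 ≤ L)
    (hg : ∀ x y, ‖gradient g x - gradient g y‖ ≤ L * ‖x - y‖) : Continuous (gradient g) :=
  (LipschitzWith.of_dist_le_mul (K := ⟨L, hL⟩) fun x y => by
    rw [dist_eq_norm, dist_eq_norm]; exact hg x y).continuous

variable {G : SimpleGraph (Fin n)} [Fintype G.edgeSet] (o : EdgeOrientation G)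
  {f : Fin n → Vec d → ℝ} {α β θ η L : ℝ}

theorem measurable_blockMul [MeasurableSpace Ω] (B : Matrix (Fin n) (Fin n) ℝ)
    {X : Ω → Fin n → Vec d} (hX : ∀ j, Measurable fun ω => X ω j) (i : Fin n) :
    Measurable fun ω => blockMul B (X ω) i :=
  Finset.measurable_fun_sum _ fun j _ => (hX j).const_smul (B i j)

/-- The primal update does not use the fresh seed: nothing is required of `q`. Hence the vector to
be compressed is measurable with respect to the past, which gives its independence of that seed. -/
theorem MeasurableState.step_x [MeasurableSpace Ω] {s : Ω → TiCoPDState n d}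
    (hs : MeasurableState s) (hgrad : ∀ i, Continuous (gradient (f i)))
    (q : Ω → Fin n → Vec d → Vec d) (i : Fin n) :
    Measurable fun ω => (ticopdStep o f α β θ η (q ω) (s ω)).x i :=
  (((hs.x i).const_smul β).add ((hs.xhat i).const_smul (1 - β))).sub
    (((((hgrad i).measurable.comp (hs.x i)).add (hs.lam i)).add
      ((measurable_blockMul (laplacian o) hs.xhat i).const_smul θ)).const_smul α)

theorem MeasurableState.step [MeasurableSpace Ω] {s : Ω → TiCoPDState n d}
    (hs : MeasurableState s) (hgrad : ∀ i, Continuous (gradient (f i)))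
    {S : Fin n → Type*} [∀ i, MeasurableSpace (S i)] {Q : (i : Fin n) → Vec d → S i → Vec d}
    (hQ : ∀ i, Measurable (fun p : Vec d × S i => Q i p.1 p.2)) {z : Ω → (i : Fin n) → S i}
    (hz : Measurable z) :
    MeasurableState fun ω => ticopdStep o f α β θ η (fun i u => Q i u (z ω i)) (s ω) where
  x := hs.step_x o hgrad _
  xhat i := (hs.xhat i).add ((hQ i).comp
    (((hs.step_x (η := η) o hgrad (fun ω i u => Q i u (z ω i)) i).sub (hs.xhat i)).prodMk
      ((measurable_pi_apply i).comp hz)))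
  lam i := (hs.lam i).add ((measurable_blockMul (laplacian o) hs.xhat i).const_smul η)

variable [MeasurableSpace Ω] {μ : Measure Ω} [IsProbabilityMeasure μ]

theorem SquareIntegrableState.step_x {s : Ω → TiCoPDState n d}
    (hs : SquareIntegrableState s μ) (hL0 : 0 ≤ L)
    (hL : ∀ i x y, ‖gradient (f i) x - gradient (f i) y‖ ≤ L * ‖x - y‖)
    (q : Ω → Fin n → Vec d → Vec d) (i : Fin n) :
    MemLp (fun ω => (ticopdStep o f α β θ η (q ω) (s ω)).x i) 2 μ :=
  (((hs.x i).const_smul β).add ((hs.xhat i).const_smul (1 - β))).sub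
    ((((memLp_comp_of_lipschitz hL0 (hL i) (hs.x i)).add (hs.lam i)).add
      ((memLp_blockMul (laplacian o) hs.xhat i).const_smul θ)).const_smul α)

/-- A step with an independent seed keeps the second moments finite, and contracts the
compression error in mean square. -/
theorem SquareIntegrableState.step {s : Ω → TiCoPDState n d}
    (hs : SquareIntegrableState s μ) (hsm : MeasurableState s) (hL0 : 0 ≤ L)
    (hL : ∀ i x y, ‖gradient (f i) x - gradient (f i) y‖ ≤ L * ‖x - y‖)
    {S : Fin n → Type*} [∀ i, MeasurableSpace (S i)] {Q : (i : Fin n) → Vec d → S i → Vec d}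
    (hQ : ∀ i, Measurable (fun p : Vec d × S i => Q i p.1 p.2)) {z : Ω → (i : Fin n) → S i}
    (hz : Measurable z) {c : ℝ} (hc0 : 0 ≤ c)
    (hc : ∀ i x, ∫⁻ ω, ENNReal.ofReal (‖Q i x (z ω i) - x‖ ^ 2) ∂μ ≤ ENNReal.ofReal (c * ‖x‖ ^ 2))
    (hind : ∀ Y : Ω → Vec d, (∃ i, Y = fun ω =>
      (ticopdStep o f α β θ η (fun i u => Q i u (z ω i)) (s ω)).x i - (s ω).xhat i) →
      IndepFun Y z μ)
    {s' : Ω → TiCoPDState n d}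
    (hs' : s' = fun ω => ticopdStep o f α β θ η (fun i u => Q i u (z ω i)) (s ω)) :
    SquareIntegrableState s' μ ∧
      ∫ ω, stackNormSq (fun i => (s' ω).xhat i - (s' ω).x i) ∂μ
        ≤ c * ∫ ω, stackNormSq (fun i => (s' ω).x i - (s ω).xhat i) ∂μ := by
  have hgrad i := continuous_gradient_of_lipschitz hL0 (hL i)
  have hx : ∀ i, MemLp (fun ω => (s' ω).x i) 2 μ := fun i => by
    rw [hs']; exact hs.step_x o hL0 hL _ i
  have hxm : ∀ i, Measurable fun ω => (s' ω).x i := fun i => by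
    rw [hs']; exact hsm.step_x o hgrad _ i
  have hy : ∀ i, MemLp (fun ω => (s' ω).x i - (s ω).xhat i) 2 μ := fun i => (hx i).sub (hs.xhat i)
  have hcomp : ∀ i, _ := fun i => memLp_compress (hQ i) ((hxm i).sub (hsm.xhat i))
    ((measurable_pi_apply i).comp hz)
    ((hind _ ⟨i, by rw [hs']; rfl⟩).comp measurable_id (measurable_pi_apply i)) (hy i) hc0 (hc i)
  -- The new error is the compressor's own error at `X' - X̂`, agent by agent, so no independence
  -- between agents is needed.
  have hxhat : ∀ i ω, (s' ω).xhat i - (s' ω).x i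
      = Q i ((s' ω).x i - (s ω).xhat i) (z ω i) - ((s' ω).x i - (s ω).xhat i) := by
    intro i ω
    have : (s' ω).xhat i = (s ω).xhat i + Q i ((s' ω).x i - (s ω).xhat i) (z ω i) := by
      rw [hs']; rfl
    rw [this]
    abel
  have he : ∀ i, MemLp (fun ω => (s' ω).xhat i - (s' ω).x i) 2 μ := fun i => by
    simp only [hxhat]
    exact (hcomp i).1
  refine ⟨⟨hx, fun i => ?_, fun i => ?_⟩, ?_⟩
  · exact ((he i).add (hx i)).ae_eq (Filter.Eventually.of_forall fun ω => sub_add_cancel _ _)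
  · rw [hs']
    exact (hs.lam i).add ((memLp_blockMul (laplacian o) hs.xhat i).const_smul η)
  · simp only [stackNormSq]
    rw [integral_finsetSum _ fun i _ => (memLp_two_iff_integrable_norm_sq (he i).1).mp (he i),
      integral_finsetSum _ fun i _ => (memLp_two_iff_integrable_norm_sq (hy i).1).mp (hy i),
      Finset.mul_sum]
    refine Finset.sum_le_sum fun i _ => ?_
    simp only [hxhat]
    exact (hcomp i).2

/-- The objective gap is the only term that is not quadratic; it lies between `0` and the quadratic
upper bound from the descent lemma at the origin. -/
theorem SquareIntegrableState.integrable_lyapunov (hn : n ≠ 0) {s : Ω → TiCoPDState n d}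
    (hs : SquareIntegrableState s μ) (hL0 : 0 ≤ L) (hf : ∀ i, Differentiable ℝ (f i))
    (hL : ∀ i x y, ‖gradient (f i) x - gradient (f i) y‖ ≤ L * ‖x - y‖)
    {fstar : ℝ} (hfstar : fstar ∈ lowerBounds (Set.range (avgObj f))) (δ ρ₂ a : ℝ) :
    Integrable (fun ω => lyapunov o f fstar α θ η δ ρ₂ a (s ω)) μ := by
  have hxbar := memLp_netAvg hs.x
  have hv : ∀ i, MemLp (fun ω => dualError f α (s ω) i) 2 μ := fun i =>
    ((hs.lam i).add (memLp_comp_of_lipschitz hL0 (hL i) hxbar)).const_smul α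
  have hobj : Integrable (fun ω => avgObj f (netAvg (s ω).x) - fstar) μ := by
    have hmeas : AEStronglyMeasurable (fun ω => avgObj f (netAvg (s ω).x) - fstar) μ :=
      ((differentiable_avgObj hf).continuous.comp_aestronglyMeasurable hxbar.1).sub
        aestronglyMeasurable_const
    have hbd : Integrable (fun ω => (avgObj f 0 - fstar)
        + inner ℝ (avgGrad f 0) (netAvg (s ω).x) + L / 2 * ‖netAvg (s ω).x‖ ^ 2) μ :=
      ((integrable_const _).add (integrable_inner_of_memLp (memLp_const _) hxbar)).add
        (((memLp_two_iff_integrable_norm_sq hxbar.1).mp hxbar).const_mul _)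
    refine hbd.mono' hmeas (Filter.Eventually.of_forall fun ω => ?_)
    have h1 := hfstar (Set.mem_range_self (netAvg (s ω).x))
    have h2 := avgObj_add_le hn hf hL 0 (netAvg (s ω).x)
    rw [zero_add] at h2
    rw [Real.norm_of_nonneg (by linarith)]
    linarith
  exact (((hobj.add ((integrable_wInner _ hv hv).const_mul _)).add
    ((integrable_wInner _ hs.x hs.x).const_mul a)).add
    ((integrable_wInner _ hs.x hv).const_mul _)).add
    ((integrable_stackNormSq fun i => (hs.xhat i).sub (hs.x i)).const_mul _)

end RandomState

end

/-! ### Expectation, telescoping and the rate. -/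

theorem theorem1
    {n d : ℕ} (hn : 2 ≤ n)
    -- the communication graph, with its incidence matrix
    (G : SimpleGraph (Fin n)) [DecidableRel G.Adj] (hG : G.Connected) (o : EdgeOrientation G)
    -- the local objectives are L-smooth, and the global one is bounded below
    (f : Fin n → Vec d → ℝ) (L : ℝ) (hL : 0 ≤ L)
    (hdiff : ∀ i, Differentiable ℝ (f i))
    (hsmooth : ∀ i x y, ‖gradient (f i) x - gradient (f i) y‖ ≤ L * ‖x - y‖)
    (fstar : ℝ) (hfstar : IsGLB (Set.range (avgObj f)) fstar)
    -- the graph assumption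
    (ρ₁ ρ₂ : ℝ) (hρ₂ : 0 < ρ₂) (hρ : ρ₂ ≤ ρ₁)
    (hlow : (laplacian o - ρ₂ • consensusMatrix n).PosSemidef)
    (hupp : (ρ₁ • consensusMatrix n - laplacian o).PosSemidef)
    -- the compressor, its random seeds, and the contraction assumption
    {Ω : Type*} [MeasurableSpace Ω] (μ : Measure Ω) [IsProbabilityMeasure μ]
    {S : Fin n → Type*} [∀ i, MeasurableSpace (S i)]
    (Q : (i : Fin n) → Vec d → S i → Vec d)
    (hQ : ∀ i, Measurable (fun p : Vec d × S i => Q i p.1 p.2))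
    (ξ : ℕ → (i : Fin n) → Ω → S i) (hξ : ∀ t i, Measurable (ξ t i))
    (hindep : iIndepFun (fun (t : ℕ) (ω : Ω) (i : Fin n) => ξ t i ω) μ)
    (δ : ℝ) (hδ : 0 < δ) (hδ1 : δ ≤ 1)
    (hcompress : ∀ t i x,
      ∫⁻ ω, ENNReal.ofReal (‖Q i x (ξ t i ω) - x‖ ^ 2) ∂μ
        ≤ ENNReal.ofReal ((1 - δ) ^ 2 * ‖x‖ ^ 2))
    -- the free quantity a, and the step sizes
    (a η θ αt α β : ℝ) (ha : 0 < a) (hη : 0 < η)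
    (hθ : thetaLB n L ρ₁ ρ₂ η δ a ≤ θ)
    (hαt : 0 < αt)
    (hα : α = 1 / (1 / αt + θ * laplacianNorm o))
    (hβ : β = α / αt)
    (hαub : α ≤ alphaUB n (laplacianNorm o) ρ₁ η δ θ a)
    -- the initialization and the iterates
    (x₀ xhat₀ : Fin n → Vec d) (lam₀ : G.edgeSet → Vec d)
    (s : ℕ → Ω → TiCoPDState n d)
    (hs : ∀ t ω, s t ω = ticopd o f α β θ η Q x₀ xhat₀ lam₀ (fun k i => ξ k i ω) t)
    (F : ℕ → Ω → ℝ)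
    (hF : ∀ t ω, F t ω = lyapunov o f fstar α θ η δ ρ₂ a (s t ω)) :
    -- all the expectations exist
    (∀ t, Integrable (F t) μ
      ∧ Integrable (fun ω => ‖avgGrad f (netAvg (s t ω).x)‖ ^ 2) μ
      ∧ Integrable (fun ω => wNormSq (consensusMatrix n) (s t ω).x) μ)
    -- the Lyapunov function is nonnegative
    ∧ (∀ t ω, 0 ≤ F t ω)
    -- the two bounds
    ∧ (∀ T : ℕ, 1 ≤ T →
        (1 / (T : ℝ)) * ∑ t ∈ Finset.range T,
            ∫ ω, ‖avgGrad f (netAvg (s t ω).x)‖ ^ 2 ∂μ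
          ≤ ((∫ ω, F 0 ω ∂μ) - ∫ ω, F T ω ∂μ) / (α * T / 16)
        ∧ (1 / (T : ℝ)) * ∑ t ∈ Finset.range T,
            ∫ ω, wNormSq (consensusMatrix n) (s t ω).x ∂μ
          ≤ ((∫ ω, F 0 ω ∂μ) - ∫ ω, F T ω ∂μ) / (α * θ * ρ₂ * a * T / 4))
    -- the rate O(1/T)
    ∧ ∃ C : ℝ, ∀ T : ℕ, 1 ≤ T →
        (1 / (T : ℝ)) * ∑ t ∈ Finset.range T,
            ∫ ω, ‖avgGrad f (netAvg (s t ω).x)‖ ^ 2 ∂μ ≤ C / T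
        ∧ (1 / (T : ℝ)) * ∑ t ∈ Finset.range T,
            ∫ ω, wNormSq (consensusMatrix n) (s t ω).x ∂μ ≤ C / T := by
  have hn0 : n ≠ 0 := by omega
  have hα0 : 0 < α := by
    have h1 : 0 ≤ laplacianNorm o := norm_nonneg _
    -- The first entry of `thetaLB` already gives this; `θ > 0` comes out of `hS`, which itself
    -- needs `α > 0`.
    have h2 : 0 ≤ θ := by
      refine le_trans ?_ ((le_max_left _ _).trans hθ)
      positivity
    rw [hα]
    positivity
  have hS := stepSizes_of_bounds hn hL hρ₂ hρ
    (one_le_of_laplacian_le o hn hG (hρ₂.le.trans hρ) hupp) (one_le_laplacianNorm o hn hG)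
    hδ hδ1 ha hη hα0 hθ hαub
  have hθ0 := hS.θ_pos
  have hδ₂ := hS.δ₂_ge
  let Z : ℕ → Ω → (i : Fin n) → S i := fun t ω i => ξ t i ω
  have hZ : ∀ t, Measurable (Z t) := fun t => measurable_pi_lambda _ (hξ t)
  have hsucc : ∀ t, s (t + 1)
      = fun ω => ticopdStep o f α β θ η (fun i u => Q i u (Z (t + 1) ω i)) (s t ω) := by
    intro t
    funext ω
    rw [hs, hs, ticopd]
  have hzero : ∀ ω, s 0 ω = { x := x₀, xhat := xhat₀, lam := blockMul (incidence o).transpose lam₀ } :=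
    fun ω => hs 0 ω
  -- The dual variable stays in the range of `Ãᵀ`, so its blocks sum to zero.
  have hlam : ∀ t ω, ∑ i, (s t ω).lam i = 0 := by
    intro t
    induction t with
    | zero => intro ω; rw [hzero]; exact sum_blockMul_incidence_transpose o lam₀
    | succ t ih =>
      intro ω
      rw [hsucc]
      simp only [ticopdStep]
      rw [Finset.sum_add_distrib, ih, ← Finset.smul_sum, sum_blockMul_laplacian, smul_zero,
        add_zero]
  have hgrad i := continuous_gradient_of_lipschitz hL (hsmooth i)
  have hadapt : ∀ t, @MeasurableState Ω n d (pastSigma Z t) (s t) := by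
    intro t
    induction t with
    | zero =>
      rw [funext hzero]
      exact @MeasurableState.mk _ _ _ (pastSigma Z 0) _ (fun _ => measurable_const)
        (fun _ => measurable_const) (fun _ => measurable_const)
    | succ t ih =>
      rw [hsucc]
      exact @MeasurableState.step _ _ _ _ _ o _ _ _ _ _ (pastSigma Z (t + 1)) _
        (ih.mono (pastSigma_mono Z t.le_succ)) hgrad _ _ _ hQ _ (measurable_pastSigma Z (t + 1))
  have hmeas : ∀ t, MeasurableState (s t) := fun t => (hadapt t).mono (pastSigma_le hZ t)
  have hstep : ∀ t, SquareIntegrableState (s t) μ → SquareIntegrableState (s (t + 1)) μ ∧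
      ∫ ω, stackNormSq (fun i => (s (t + 1) ω).xhat i - (s (t + 1) ω).x i) ∂μ
        ≤ (1 - δ) ^ 2 * ∫ ω, stackNormSq (fun i => (s (t + 1) ω).x i - (s t ω).xhat i) ∂μ := by
    intro t ht
    refine ht.step o (hmeas t) hL hsmooth hQ (hZ (t + 1)) (sq_nonneg (1 - δ))
      (fun i x => hcompress (t + 1) i x) ?_ (hsucc t)
    rintro Y ⟨i, rfl⟩
    refine indepFun_of_measurable_pastSigma hZ hindep ?_
    exact (@MeasurableState.step_x _ _ _ _ _ o _ _ _ _ _ (pastSigma Z t) _ (hadapt t) hgrad _ i).sub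
      (@MeasurableState.xhat _ _ _ (pastSigma Z t) _ (hadapt t) i)
  have hsq : ∀ t, SquareIntegrableState (s t) μ := by
    intro t
    induction t with
    | zero =>
      rw [funext hzero]
      exact ⟨fun _ => memLp_const _, fun _ => memLp_const _, fun _ => memLp_const _⟩
    | succ t ih => exact (hstep t ih).1
  have hFint : ∀ t, Integrable (F t) μ := by
    intro t
    rw [funext (hF t)]
    exact (hsq t).integrable_lyapunov o hn0 hL hdiff hsmooth hfstar.1 δ ρ₂ a
  have hGint : ∀ t, Integrable (fun ω => ‖avgGrad f (netAvg (s t ω).x)‖ ^ 2) μ := by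
    intro t
    have h := memLp_comp_of_lipschitz hL (norm_avgGrad_sub_le hn0 hsmooth) (memLp_netAvg (hsq t).x)
    exact (memLp_two_iff_integrable_norm_sq h.1).mp h
  have hKint : ∀ t, Integrable (fun ω => wNormSq (consensusMatrix n) (s t ω).x) μ := fun t =>
    integrable_wInner _ (hsq t).x (hsq t).x
  have hFnonneg : ∀ t ω, 0 ≤ F t ω := fun t ω => by
    rw [hF]; exact lyapunov_nonneg o hn0 hfstar.1 ha hS _
  have hK0 : ∀ t ω, 0 ≤ wNormSq (consensusMatrix n) (s t ω).x := fun t ω => by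
    rw [wNormSq, wInner_eq_inner, inner_consensusMatrix hn0]
    exact real_inner_self_nonneg
  set gradErr : ℕ → ℝ := fun t => ∫ ω, ‖avgGrad f (netAvg (s t ω).x)‖ ^ 2 ∂μ with hgradErr
  set consErr : ℕ → ℝ := fun t => ∫ ω, wNormSq (consensusMatrix n) (s t ω).x ∂μ with hconsErr
  have hg0 : ∀ t, 0 ≤ gradErr t := fun t => integral_nonneg fun ω => by positivity
  have hc0 : ∀ t, 0 ≤ consErr t := fun t => integral_nonneg fun ω => hK0 t ω
  have hdescent : ∀ t, α / 16 * gradErr t + α * θ * ρ₂ * a / 4 * consErr t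
      ≤ (∫ ω, F t ω ∂μ) - ∫ ω, F (t + 1) ω ∂μ := by
    intro t
    have hE := integrable_stackNormSq fun i => ((hsq (t + 1)).xhat i).sub ((hsq (t + 1)).x i)
    have hY := integrable_stackNormSq fun i => ((hsq (t + 1)).x i).sub ((hsq t).xhat i)
    have h1 : ∀ ω, F (t + 1) ω
        - delta2 η δ * a * stackNormSq (fun i => (s (t + 1) ω).xhat i - (s (t + 1) ω).x i)
        + delta2 η δ * a * (1 - δ) ^ 2 * stackNormSq (fun i => (s (t + 1) ω).x i - (s t ω).xhat i)
        ≤ F t ω - α / 16 * ‖avgGrad f (netAvg (s t ω).x)‖ ^ 2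
        - α * θ * ρ₂ * a / 4 * wNormSq (consensusMatrix n) (s t ω).x := by
      intro ω
      rw [hF, hF, mul_assoc (delta2 η δ * a)]
      exact lyapunov_step_le o hn0 hdiff hsmooth hδ hδ1 ha ((le_max_left _ _).trans hθ) hαt hα hβ
        hS hlow (s t ω) (hlam t ω) _ _ (congrFun (hsucc t) ω)
    have h2 := integral_mono
      (((hFint (t + 1)).sub (hE.const_mul (delta2 η δ * a))).add
        (hY.const_mul (delta2 η δ * a * (1 - δ) ^ 2)))
      (((hFint t).sub ((hGint t).const_mul (α / 16))).sub
        ((hKint t).const_mul (α * θ * ρ₂ * a / 4))) h1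
    rw [integral_add' ((hFint (t + 1)).sub (hE.const_mul _)) (hY.const_mul _),
      integral_sub' (hFint (t + 1)) (hE.const_mul _),
      integral_sub' ((hFint t).sub ((hGint t).const_mul _)) ((hKint t).const_mul _),
      integral_sub' (hFint t) ((hGint t).const_mul _), integral_const_mul, integral_const_mul,
      integral_const_mul, integral_const_mul] at h2
    have h3 := mul_le_mul_of_nonneg_left (hstep t (hsq t)).2 (by positivity : 0 ≤ delta2 η δ * a)
    have h4 : gradErr t = ∫ ω, ‖avgGrad f (netAvg (s t ω).x)‖ ^ 2 ∂μ := rfl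
    have h5 : consErr t = ∫ ω, wNormSq (consensusMatrix n) (s t ω).x ∂μ := rfl
    rw [h4, h5]
    simp only [Pi.sub_apply] at h2
    linarith
  have htel : ∀ T, α / 16 * ∑ t ∈ Finset.range T, gradErr t
      + α * θ * ρ₂ * a / 4 * ∑ t ∈ Finset.range T, consErr t
      ≤ (∫ ω, F 0 ω ∂μ) - ∫ ω, F T ω ∂μ := by
    intro T
    rw [Finset.mul_sum, Finset.mul_sum, ← Finset.sum_add_distrib,
      ← Finset.sum_range_sub' (fun t => ∫ ω, F t ω ∂μ)]
    exact Finset.sum_le_sum fun t _ => hdescent t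
  have hG0 : ∀ T, 0 ≤ ∑ t ∈ Finset.range T, gradErr t := fun T =>
    Finset.sum_nonneg fun t _ => hg0 t
  have hC0 : ∀ T, 0 ≤ ∑ t ∈ Finset.range T, consErr t := fun T =>
    Finset.sum_nonneg fun t _ => hc0 t
  have hκ : 0 < α * θ * ρ₂ * a / 4 := by positivity
  have hbounds : ∀ T : ℕ, 1 ≤ T →
      (1 / (T : ℝ)) * ∑ t ∈ Finset.range T, gradErr t
        ≤ ((∫ ω, F 0 ω ∂μ) - ∫ ω, F T ω ∂μ) / (α * T / 16)
      ∧ (1 / (T : ℝ)) * ∑ t ∈ Finset.range T, consErr t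
        ≤ ((∫ ω, F 0 ω ∂μ) - ∫ ω, F T ω ∂μ) / (α * θ * ρ₂ * a * T / 4) := by
    intro T hT
    have hT0 : (0 : ℝ) < T := by exact_mod_cast hT
    have h1 := htel T
    have h2 := mul_nonneg hκ.le (hC0 T)
    have h3 := mul_nonneg (by positivity : 0 ≤ α / 16) (hG0 T)
    constructor
    · rw [le_div_iff₀ (by positivity)]
      calc 1 / (T : ℝ) * (∑ t ∈ Finset.range T, gradErr t) * (α * T / 16)
          = α / 16 * ∑ t ∈ Finset.range T, gradErr t := by field_simp
        _ ≤ _ := by linarith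
    · rw [le_div_iff₀ (by positivity)]
      calc 1 / (T : ℝ) * (∑ t ∈ Finset.range T, consErr t) * (α * θ * ρ₂ * a * T / 4)
          = α * θ * ρ₂ * a / 4 * ∑ t ∈ Finset.range T, consErr t := by field_simp
        _ ≤ _ := by linarith
  refine ⟨fun t => ⟨hFint t, hGint t, hKint t⟩, hFnonneg, hbounds,
    -- Dropping `E F_T ≥ 0` makes the numerator independent of `T`.
    max ((∫ ω, F 0 ω ∂μ) / (α / 16)) ((∫ ω, F 0 ω ∂μ) / (α * θ * ρ₂ * a / 4)), fun T hT => ?_⟩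
  have hT0 : (0 : ℝ) < T := by exact_mod_cast hT
  have hFT : 0 ≤ ∫ ω, F T ω ∂μ := integral_nonneg fun ω => hFnonneg T ω
  obtain ⟨h1, h2⟩ := hbounds T hT
  constructor
  · refine h1.trans ?_
    calc ((∫ ω, F 0 ω ∂μ) - ∫ ω, F T ω ∂μ) / (α * T / 16)
        ≤ (∫ ω, F 0 ω ∂μ) / (α * T / 16) := by gcongr; linarith
      _ = (∫ ω, F 0 ω ∂μ) / (α / 16) / T := by field_simp
      _ ≤ _ := div_le_div_of_nonneg_right (le_max_left _ _) hT0.le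
  · refine h2.trans ?_
    calc ((∫ ω, F 0 ω ∂μ) - ∫ ω, F T ω ∂μ) / (α * θ * ρ₂ * a * T / 4)
        ≤ (∫ ω, F 0 ω ∂μ) / (α * θ * ρ₂ * a * T / 4) := by gcongr; linarith
      _ = (∫ ω, F 0 ω ∂μ) / (α * θ * ρ₂ * a / 4) / T := by field_simp
      _ ≤ _ := div_le_div_of_nonneg_right (le_max_right _ _) hT0.le
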